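/- A weighted model is a finite set $\mathcal S\subset\mathbb Z^2$ of steps with nonzero complex weights $(w_s)_{s\in\mathcal S}$; its step polynomial is $S(X,Y)=\sum_{(i,j)\in\mathcal S}w_{i,j}X^iY^j$. It is unweighted if all weights are $1$, and not univariate if both $X$ and $Y$ occur in $S$. Its kernel polynomial is $\widetilde K(X,Y,t)=X^{m_x}Y^{m_y}(1-tS(X,Y))\in\mathbb C[X,Y,t]$, where $m_x=\max(0,\max_{(i,j)\in\mathcal S}(-i))$ and $m_y=\max(0,\max_{(i,j)\in\mathcal S}(-j))$. A fraction in $\mathbb C(X,Y,t)$ is regular if its denominator in lowest terms is not divisible by $\widetilde K$. We say that $XY$ has a Galois decoupling for the model if there are $F\in\mathbb C(X,t)$, $G\in\mathbb C(Y,t)$ and a regular fraction $R\in\mathbb C(X,Y,t)$ with $XY=F+G+\widetilde K R$. Let $\mathbb K$ be an algebraic closure of $\mathbb C(x,y)$, with $x,y$ algebraically independent over $\mathbb C$. Call two pairs $(u,v),(u',v')$ of nonzero elements of $\mathbb K$ adjacent if $S(u,v)=S(u',v')$ and moreover $u=u'$ or $v=v'$. The orbit of the model is the class of $(x,y)$ under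 the reflexive transitive closure of adjacency, regarded as a graph in which distinct adjacent pairs are joined by an edge; the orbit type is its isomorphism class as a graph. Let $\mathcal O_{18}$ be the graph whose vertices are the $18$ pairs (edge of $K_{3,3}$, endpoint of that edge), two distinct pairs being joined when they have the same edge or the same endpoint. Let $\widetilde{\mathcal O_{12}}$ be the graph whose vertices are the $12$ ordered pairs of distinct elements of a set of size $4$, two distinct pairs being joined when they have the same first entry or the same second entry. A Hadamard model is a weighted model with $S(X,Y)=P(X)Q(Y)+R(X)$ for Laurent polynomials $P,Q,R$ over $\mathbb C$, such that $\deg_X\widetilde K>1$ and $\deg_Y\widetilde K>1$. For $p\ge 2$ and $z_0,\dots,z_p\in\mathbb C$ with $z_p\ne0$, the $p$-fan is the model with $S(X,Y)=\frac1{XY}+\sum_{i=0}^{p}z_i\sum_{j=0}^{i}X^jY^{i-j}$. For $\lambda\in\mathbb C$, $\mathcal G_\lambda$ is the model with $S(X,Y)=\frac1{XY}+Y+\frac XY+X^2Y+\lambda X$. Proposition. (1) $XY$ has no Galois decoupling for any Hadamard model and, more generally, for any weighted model that is not univariate and whose orbit type is that of a Hadamard model. (2) $XY$ has no Galois decoupling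 for any $p$-fan, $p\ge2$. (3) $XY$ has no Galois decoupling for any unweighted, not univariate model with steps in $\{-1,0,1,2\}^2$ whose orbit type is $\mathcal O_{18}$ or $\widetilde{\mathcal O_{12}}$. (4) $XY$ has a Galois decoupling for $\mathcal G_\lambda$, for every $\lambda\in\mathbb C$. -/

import Mathlib

noncomputable section

namespace LargeSteps

open MvPolynomial

/-! ### Weighted models and their kernel polynomials -/

/-- A weighted model: finitely many steps `(i, j)`, each with a nonzero complex weight. It is the
family of coefficients of the step polynomial `S(X, Y) = ∑ w (i, j) X ^ i Y ^ j`. -/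
abbrev WeightedModel : Type := ℤ × ℤ →₀ ℂ

/-- The model with step set `𝒮` in which every step has weight `1`. -/
def unweighted (𝒮 : Finset (ℤ × ℤ)) : WeightedModel :=
  ∑ s ∈ 𝒮, Finsupp.single s 1

/-- The step polynomial is not univariate: both variables occur in it. -/
def IsNotUnivariate (w : WeightedModel) : Prop :=
  (∃ s ∈ w.support, s.1 ≠ 0) ∧ ∃ s ∈ w.support, s.2 ≠ 0

/-- `-mX w` is the smallest move in the `X` direction (`0` if no step has a negative one). -/
def mX (w : WeightedModel) : ℕ := w.support.sup fun s => (-s.1).toNat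

/-- `-mY w` is the smallest move in the `Y` direction (`0` if no step has a negative one). -/
def mY (w : WeightedModel) : ℕ := w.support.sup fun s => (-s.2).toNat

/-- The ring `ℂ[X, Y, t]`; the variables are `X 0`, `X 1`, `X 2` in this order. -/
abbrev Poly3 : Type := MvPolynomial (Fin 3) ℂ

/-- The field `ℂ(X, Y, t)`. -/
abbrev Frac3 : Type := FractionRing Poly3

/-- The variable `X` in `ℂ(X, Y, t)`. -/
def fX : Frac3 := algebraMap Poly3 Frac3 (X 0)

/-- The variable `Y` in `ℂ(X, Y, t)`. -/
def fY : Frac3 := algebraMap Poly3 Frac3 (X 1)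

/-- The variable `t` in `ℂ(X, Y, t)`. -/
def ft : Frac3 := algebraMap Poly3 Frac3 (X 2)

/-- The kernel polynomial `X ^ m_x Y ^ m_y (1 - t S(X, Y))`. The exponents `i + m_x` and `j + m_y`
are nonnegative on the support of `w`, so that `Int.toNat` does not truncate. -/
def kernelPoly (w : WeightedModel) : Poly3 :=
  X 0 ^ mX w * X 1 ^ mY w -
    X 2 * w.sum fun s c => C c * X 0 ^ (s.1 + mX w).toNat * X 1 ^ (s.2 + mY w).toNat

/-! ### Galois decoupling -/

/-- A fraction is regular for the model `w` if, in lowest terms, its denominator is not divisible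
by the kernel polynomial. -/
def IsRegular (w : WeightedModel) (H : Frac3) : Prop :=
  ∃ A B : Poly3, B ≠ 0 ∧ IsRelPrime A B ∧
    H = algebraMap Poly3 Frac3 A / algebraMap Poly3 Frac3 B ∧ ¬ kernelPoly w ∣ B

/-- The subfield `ℂ(X, t)` of `ℂ(X, Y, t)`. -/
def fieldXt : IntermediateField ℂ Frac3 := IntermediateField.adjoin ℂ {fX, ft}

/-- The subfield `ℂ(Y, t)` of `ℂ(X, Y, t)`. -/
def fieldYt : IntermediateField ℂ Frac3 := IntermediateField.adjoin ℂ {fY, ft}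

/-- The fraction `H` has a Galois decoupling for the model `w`. -/
def HasGaloisDecoupling (w : WeightedModel) (H : Frac3) : Prop :=
  ∃ F ∈ fieldXt, ∃ G ∈ fieldYt, ∃ R : Frac3, IsRegular w R ∧
    H = F + G + algebraMap Poly3 Frac3 (kernelPoly w) * R

/-! ### The orbit of the walk -/

/-- The field `ℂ(x, y)`. -/
abbrev BaseField : Type := FractionRing (MvPolynomial (Fin 2) ℂ)

/-- An algebraic closure `𝕂` of `ℂ(x, y)`. -/
abbrev KK : Type := AlgebraicClosure BaseField

lemma algebraMap_X_ne_zero (i : Fin 2) :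
    algebraMap BaseField KK (algebraMap (MvPolynomial (Fin 2) ℂ) BaseField (X i)) ≠ 0 := by
  rw [Ne, map_eq_zero_iff _ (algebraMap BaseField KK).injective,
    map_eq_zero_iff _ (IsFractionRing.injective (MvPolynomial (Fin 2) ℂ) BaseField)]
  exact X_ne_zero i

/-- The variable `x`, as a nonzero element of `𝕂`. -/
def xK : KKˣ := Units.mk0 _ (algebraMap_X_ne_zero 0)

/-- The variable `y`, as a nonzero element of `𝕂`. -/
def yK : KKˣ := Units.mk0 _ (algebraMap_X_ne_zero 1)

/-- The value `S(u, v)` of the step polynomial at a pair of nonzero elements of `𝕂`. -/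
def stepEval (w : WeightedModel) (p : KKˣ × KKˣ) : KK :=
  w.sum fun s c => algebraMap ℂ KK c * ((p.1 ^ s.1 : KKˣ) : KK) * ((p.2 ^ s.2 : KKˣ) : KK)

/-- The relation `(u, v) ∼ˣ (u', v')`. -/
def XAdjacent (w : WeightedModel) (p q : KKˣ × KKˣ) : Prop :=
  p.1 = q.1 ∧ stepEval w p = stepEval w q

/-- The relation `(u, v) ∼ʸ (u', v')`. -/
def YAdjacent (w : WeightedModel) (p q : KKˣ × KKˣ) : Prop :=
  p.2 = q.2 ∧ stepEval w p = stepEval w q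

/-- The relation `(u, v) ∼ (u', v')`. -/
def Adjacent (w : WeightedModel) (p q : KKˣ × KKˣ) : Prop :=
  XAdjacent w p q ∨ YAdjacent w p q

/-- The orbit of the walk: the class of `(x, y)` under the reflexive transitive closure of `∼`. -/
def Orbit (w : WeightedModel) : Set (KKˣ × KKˣ) :=
  {p | Relation.ReflTransGen (Adjacent w) (xK, yK) p}

/-- The graph structure of the orbit: distinct pairs are joined when they are adjacent. -/
def orbitGraph (w : WeightedModel) : SimpleGraph (Orbit w) :=
  SimpleGraph.fromRel fun p q => Adjacent w p.1 q.1

/-- Two graphs belong to the same orbit type if they are isomorphic. The orbit type of `w` is the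
one of the graph `Γ`. -/
def HasOrbitType (w : WeightedModel) {V : Type*} (Γ : SimpleGraph V) : Prop :=
  Nonempty (orbitGraph w ≃g Γ)

/-- The orbit type `𝒪₁₈`. Its vertices are the `18` pairs consisting of an edge `(a, b)` of the
complete bipartite graph `K₃,₃` and an endpoint of this edge (`false` for `a`, `true` for `b`). Two
of them are joined if they have the same edge (cliques of size `2` of one colour) or the same
endpoint (cliques of size `3` of the other colour). -/
def O18 : SimpleGraph ((Fin 3 × Fin 3) × Bool) :=
  SimpleGraph.fromRel fun p q =>
    p.1 = q.1 ∨
    (p.2 = false ∧ q.2 = false ∧ p.1.1 = q.1.1) ∨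
    (p.2 = true ∧ q.2 = true ∧ p.1.2 = q.1.2)

/-- The orbit type `𝒪̃₁₂`. Its vertices are the `12` ordered pairs of distinct elements of a set
of size `4`. Two of them are joined if they have the same first entry (cliques of size `3` of one
colour) or the same second entry (cliques of size `3` of the other colour). -/
def O12tilde : SimpleGraph {p : Fin 4 × Fin 4 // p.1 ≠ p.2} :=
  SimpleGraph.fromRel fun p q => p.1.1 = q.1.1 ∨ p.1.2 = q.1.2

/-! ### The families of models -/

/-- Hadamard models: `S(X, Y) = P(X) Q(Y) + R(X)` for three Laurent polynomials `P`, `Q`, `R`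
(given here by their coefficients), where the kernel polynomial has degree at least `2` in `X` and
in `Y`. -/
def IsHadamard (w : WeightedModel) : Prop :=
  (∃ P Q R : ℤ →₀ ℂ, ∀ i j : ℤ, w (i, j) = P i * Q j + if j = 0 then R i else 0) ∧
    1 < (kernelPoly w).degreeOf 0 ∧ 1 < (kernelPoly w).degreeOf 1

/-- The orbit type of `w` is the orbit type of a Hadamard model. -/
def HasHadamardOrbitType (w : WeightedModel) : Prop :=
  ∃ w' : WeightedModel, IsHadamard w' ∧ HasOrbitType w (orbitGraph w')

/-- The `p`-fan with weights `z 0, …, z p`: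
`S(X, Y) = 1 / (X Y) + ∑_{i ≤ p} z i ∑_{0 ≤ j ≤ i} X ^ j Y ^ (i - j)`. -/
def fan (p : ℕ) (z : ℕ → ℂ) : WeightedModel :=
  Finsupp.single (-1, -1) 1 +
    ∑ i ∈ Finset.range (p + 1), ∑ j ∈ Finset.range (i + 1),
      Finsupp.single ((j : ℤ), (i : ℤ) - (j : ℤ)) (z i)

/-- The model `𝒢_lam`: `S(X, Y) = 1 / (X Y) + Y + X / Y + X ^ 2 Y + lam X`. -/
def modelG (lam : ℂ) : WeightedModel :=
  Finsupp.single (-1, -1) 1 + Finsupp.single (0, 1) 1 + Finsupp.single (1, -1) 1 +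
    Finsupp.single (2, 1) 1 + Finsupp.single (1, 0) lam

end LargeSteps

end

/-! The obstruction in (1)-(3) comes from evaluating on the orbit. Put τ = 1/S(x,y). Every pair
(u,v) of the orbit is again algebraically independent over ℂ and has S(u,v) = 1/τ, and the
polynomials vanishing at (u,v,τ) are exactly the multiples of the kernel polynomial
(`Generic.kernelPoly_dvd`). A regular R therefore has a finite value there, and XY = F + G + K̃R
becomes uv = F(u) + G(v) on the whole orbit, with τ constant (`exists_decoupling_on_orbit`).

If the orbit contains {u,u'} × {v,v'}, the alternating sum over the four corners gives (u-u')(v-v')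
= 0, which is absurd. Such squares are the induced 4-cycles of the orbit graph, so the obstruction
depends on the orbit type only. Hadamard models, fans and Õ₁₂ all contain one.

O₁₈ needs another argument. Up to exchanging coordinates, the orbit has abscissas U i j whose
vertical fibres are {a i, b j}, with i, j in `Fin 3`. The kernel is then quadratic in V and cubic in
U, say A V² + B V + C. A Bézout determinant E(s,t) expresses that s and t are the two roots for a
common U; it is symmetric, cubic in each variable, and vanishes on the grid (a i, b j).
Interpolation shows that E has rank at most 2, so every 3 × 3 determinant of its values vanishes
(`gridDet_eq_zero`). One such determinant at integer nodes is an integer polynomial in the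
transcendental number σ = S(x,y), hence zero, hence zero modulo 10⁹+7 at σ = 7. Checking all 4096
step sets in each of the two possible vertical positions leaves only models with S - ε = (1+Y)(X² +
1/(XY)) or (1+Y)(1/X + X²/Y), where ε is 0 or 1. There U is explicit in a i and b j, and a
decoupling would force two of the b's to agree (`false_of_factored_grid`).

For (4), solving the equation K̃ = 0 for XY gives the decoupling at once. -/

noncomputable section

namespace LargeSteps

open MvPolynomial

/-! ### Generic pairs -/

/-- A pair of elements of `𝕂` is generic if it is algebraically independent over `ℂ`. -/
def Generic (p : KKˣ × KKˣ) : Prop := AlgebraicIndependent ℂ ![(p.1 : KK), (p.2 : KK)]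

lemma generic_xK_yK : Generic (xK, yK) := by
  have h : AlgebraicIndependent ℂ (X : Fin 2 → MvPolynomial (Fin 2) ℂ) :=
    MvPolynomial.algebraicIndependent_X _ _
  have h1 := h.map' (f := IsScalarTower.toAlgHom ℂ (MvPolynomial (Fin 2) ℂ) BaseField)
    (IsFractionRing.injective (MvPolynomial (Fin 2) ℂ) BaseField)
  have h2 := h1.map' (f := IsScalarTower.toAlgHom ℂ BaseField KK)
    (algebraMap BaseField KK).injective
  unfold Generic
  convert h2 using 1
  ext i
  fin_cases i <;> rfl

lemma Generic.swap {p : KKˣ × KKˣ} (h : Generic p) : Generic p.swap := by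
  unfold Generic at *
  have := h.comp (Equiv.swap (0 : Fin 2) 1) (Equiv.injective _)
  convert this using 1
  ext i
  fin_cases i <;> simp

lemma algebraicIndependent_pair_iff {F K : Type*} [Field F] [Field K] [Algebra F K] (a b : K) :
    AlgebraicIndependent F ![a, b] ↔
      Transcendental F a ∧ Transcendental (IntermediateField.adjoin F {a}) b := by
  rw [AlgebraicIndependent.iff_transcendental_adjoin_image 1,
    IntermediateField.transcendental_adjoin_iff]
  have hset : (![a, b] : Fin 2 → K) '' {1}ᶜ = {a} := by
    ext z
    simp only [Set.mem_image, Set.mem_compl_iff, Set.mem_singleton_iff, Fin.exists_fin_two]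
    simp [eq_comm]
  have : Unique {j : Fin 2 // j ≠ 1} := ⟨⟨⟨0, by decide⟩⟩, by decide⟩
  rw [hset, algebraicIndependent_unique_type_iff]
  have hd : ((default : {j : Fin 2 // j ≠ 1}) : Fin 2) = 0 := by
    have := (default : {j : Fin 2 // j ≠ 1}).2
    omega
  simp [hd]

/-! ### Evaluating Laurent polynomials -/

lemma neg_le_mX {w : WeightedModel} {s : ℤ × ℤ} (hs : s ∈ w.support) : 0 ≤ s.1 + mX w := by
  have := Finset.le_sup (f := fun s : ℤ × ℤ => (-s.1).toNat) hs
  simp only [mX] at *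
  omega

lemma neg_le_mY {w : WeightedModel} {s : ℤ × ℤ} (hs : s ∈ w.support) : 0 ≤ s.2 + mY w := by
  have := Finset.le_sup (f := fun s : ℤ × ℤ => (-s.2).toNat) hs
  simp only [mY] at *
  omega

/-- The polynomial `X ^ m_x Y ^ m_y S(X, Y)`. -/
def numPoly (σ : Type*) (i j : σ) (w : WeightedModel) : MvPolynomial σ ℂ :=
  w.sum fun s c => C c * X i ^ (s.1 + mX w).toNat * X j ^ (s.2 + mY w).toNat

lemma aeval_numPoly {σ : Type*} (i j : σ) (w : WeightedModel) (f : σ → KK) (p : KKˣ × KKˣ)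
    (hi : f i = p.1) (hj : f j = p.2) :
    aeval f (numPoly σ i j w) = (p.1 : KK) ^ mX w * (p.2 : KK) ^ mY w * stepEval w p := by
  simp only [numPoly, stepEval, Finsupp.sum, map_sum, Finset.mul_sum, map_mul, map_pow, aeval_X,
    hi, hj]
  refine Finset.sum_congr rfl fun s hs => ?_
  have h1 : (p.1 : KK) ^ (s.1 + mX w).toNat = p.1 ^ mX w * ((p.1 ^ s.1 : KKˣ) : KK) := by
    have : p.1 ^ (s.1 + mX w).toNat = p.1 ^ mX w * p.1 ^ s.1 := by
      rw [← zpow_natCast, Int.toNat_of_nonneg (neg_le_mX hs), zpow_add, zpow_natCast, mul_comm]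
    exact_mod_cast congrArg Units.val this
  have h2 : (p.2 : KK) ^ (s.2 + mY w).toNat = p.2 ^ mY w * ((p.2 ^ s.2 : KKˣ) : KK) := by
    have : p.2 ^ (s.2 + mY w).toNat = p.2 ^ mY w * p.2 ^ s.2 := by
      rw [← zpow_natCast, Int.toNat_of_nonneg (neg_le_mY hs), zpow_add, zpow_natCast, mul_comm]
    exact_mod_cast congrArg Units.val this
  rw [h1, h2, aeval_C]
  ring

lemma coeff_numPoly {σ : Type*} [DecidableEq σ] {i j : σ} (hij : i ≠ j) (w : WeightedModel)
    {s : ℤ × ℤ} (hs : s ∈ w.support) :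
    coeff (Finsupp.single i (s.1 + mX w).toNat + Finsupp.single j (s.2 + mY w).toNat)
      (numPoly σ i j w) = w s := by
  have hm : ∀ r : ℤ × ℤ, C (w r) * (X i : MvPolynomial σ ℂ) ^ (r.1 + mX w).toNat *
      X j ^ (r.2 + mY w).toNat = monomial (Finsupp.single i (r.1 + mX w).toNat +
        Finsupp.single j (r.2 + mY w).toNat) (w r) := by
    intro r
    rw [X_pow_eq_monomial, X_pow_eq_monomial, C_mul_monomial, monomial_mul, mul_one, mul_one]
  simp only [numPoly, Finsupp.sum, coeff_sum, hm, coeff_monomial]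
  rw [Finset.sum_eq_single_of_mem s hs, if_pos rfl]
  intro r hr hrs
  refine if_neg fun h => hrs ?_
  have h1 := DFunLike.congr_fun h i
  have h2 := DFunLike.congr_fun h j
  simp only [Finsupp.add_apply, Finsupp.single_eq_same, Finsupp.single_eq_of_ne hij,
    Finsupp.single_eq_of_ne hij.symm, add_zero, zero_add] at h1 h2
  have := neg_le_mX hr
  have := neg_le_mX hs
  have := neg_le_mY hr
  have := neg_le_mY hs
  ext <;> omega

/-- Clearing denominators sends distinct steps to distinct monomials, so a relation among the
monomials at p would be a polynomial relation between independent elements. -/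
lemma stepEval_ne_zero {w : WeightedModel} (hw : w ≠ 0) {p : KKˣ × KKˣ} (hp : Generic p) :
    stepEval w p ≠ 0 := by
  intro h
  have h1 := aeval_numPoly (σ := Fin 2) 0 1 w ![(p.1 : KK), p.2] p rfl rfl
  rw [h, mul_zero] at h1
  have h2 := (algebraicIndependent_iff.1 hp) _ h1
  obtain ⟨s, hs⟩ := Finsupp.support_nonempty_iff.2 hw
  have h3 := coeff_numPoly (σ := Fin 2) (i := 0) (j := 1) (by decide) w hs
  rw [h2, coeff_zero] at h3
  exact (Finsupp.mem_support_iff.1 hs) h3.symm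

lemma stepEval_zero (p : KKˣ × KKˣ) : stepEval 0 p = 0 := Finsupp.sum_zero_index

lemma stepEval_add (w w' : WeightedModel) (p : KKˣ × KKˣ) :
    stepEval (w + w') p = stepEval w p + stepEval w' p := by
  unfold stepEval
  refine Finsupp.sum_add_index' (by simp) fun s c d => ?_
  rw [map_add]
  ring

lemma stepEval_single (s : ℤ × ℤ) (c : ℂ) (p : KKˣ × KKˣ) :
    stepEval (Finsupp.single s c) p =
      algebraMap ℂ KK c * ((p.1 ^ s.1 : KKˣ) : KK) * ((p.2 ^ s.2 : KKˣ) : KK) := by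
  unfold stepEval
  exact Finsupp.sum_single_index (by simp)

/-- Evaluation of Laurent polynomials as an additive map. -/
def stepEvalHom (p : KKˣ × KKˣ) : WeightedModel →+ KK where
  toFun w := stepEval w p
  map_zero' := stepEval_zero p
  map_add' w w' := stepEval_add w w' p

lemma stepEval_sum {ι : Type*} (T : Finset ι) (f : ι → WeightedModel) (p : KKˣ × KKˣ) :
    stepEval (∑ i ∈ T, f i) p = ∑ i ∈ T, stepEval (f i) p :=
  map_sum (stepEvalHom p) f T

lemma stepEval_sub (w w' : WeightedModel) (p : KKˣ × KKˣ) :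
    stepEval (w - w') p = stepEval w p - stepEval w' p :=
  map_sub (stepEvalHom p) w w'

/-! ### The transposed model -/

/-- The model in which the roles of `X` and `Y` are exchanged. -/
def transpose (w : WeightedModel) : WeightedModel := Finsupp.equivMapDomain (Equiv.prodComm ℤ ℤ) w

lemma transpose_apply (w : WeightedModel) (s : ℤ × ℤ) : transpose w s = w s.swap := rfl

lemma stepEval_transpose (w : WeightedModel) (p : KKˣ × KKˣ) :
    stepEval (transpose w) p.swap = stepEval w p := by
  unfold stepEval transpose
  rw [Finsupp.equivMapDomain_eq_mapDomain, Finsupp.sum_mapDomain_index_inj (Equiv.injective _)]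
  refine Finsupp.sum_congr fun s _ => ?_
  simp only [Equiv.prodComm_apply, Prod.fst_swap, Prod.snd_swap]
  ring

lemma mem_support_transpose {w : WeightedModel} {s : ℤ × ℤ} :
    s ∈ (transpose w).support ↔ s.swap ∈ w.support := by
  simp [Finsupp.mem_support_iff, transpose_apply]

/-! ### Rows of a model -/

/-- The coefficient of `Y ^ j` in the step polynomial, as a model. -/
def row (w : WeightedModel) (j : ℤ) : WeightedModel := w.filter fun s => s.2 = j

lemma row_ne_zero {w : WeightedModel} {s : ℤ × ℤ} (hs : s ∈ w.support) : row w s.2 ≠ 0 := by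
  intro h
  have := DFunLike.congr_fun h s
  rw [row, Finsupp.filter_apply_pos (fun r : ℤ × ℤ => r.2 = s.2) w rfl] at this
  exact (Finsupp.mem_support_iff.1 hs) this

/-- The value at `u` of the coefficient of `Y ^ j` in the step polynomial. -/
def rowEval (w : WeightedModel) (j : ℤ) (u : KKˣ) : KK := stepEval (row w j) (u, 1)

lemma stepEval_row (w : WeightedModel) (j : ℤ) (p : KKˣ × KKˣ) :
    stepEval (row w j) p = rowEval w j p.1 * ((p.2 ^ j : KKˣ) : KK) := by
  unfold rowEval stepEval
  rw [Finsupp.sum, Finsupp.sum, Finset.sum_mul]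
  refine Finset.sum_congr rfl fun s hs => ?_
  have : s.2 = j := by
    rw [row, Finsupp.support_filter, Finset.mem_filter] at hs
    exact hs.2
  simp [this]

lemma rowEval_ne_zero {w : WeightedModel} {s : ℤ × ℤ} (hs : s ∈ w.support) {p : KKˣ × KKˣ}
    (hp : Generic p) : rowEval w s.2 p.1 ≠ 0 := by
  intro h
  have := stepEval_ne_zero (row_ne_zero hs) hp
  rw [stepEval_row, h, zero_mul] at this
  exact this rfl

lemma rowEval_eq_zero {w : WeightedModel} {j : ℤ} (h : ∀ s ∈ w.support, s.2 ≠ j) (u : KKˣ) :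
    rowEval w j u = 0 := by
  have : row w j = 0 := by
    rw [row, Finsupp.filter_eq_zero_iff]
    intro s hs
    by_contra hc
    exact h s (Finsupp.mem_support_iff.2 hc) hs
  rw [rowEval, this, stepEval_zero]

lemma stepEval_eq_sum_rows (w : WeightedModel) (J : Finset ℤ) (hJ : ∀ s ∈ w.support, s.2 ∈ J)
    (p : KKˣ × KKˣ) :
    stepEval w p = ∑ j ∈ J, rowEval w j p.1 * ((p.2 ^ j : KKˣ) : KK) := by
  have : w = ∑ j ∈ J, row w j := by
    ext s
    rw [Finsupp.finsetSum_apply]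
    by_cases hs : s ∈ w.support
    · rw [Finset.sum_eq_single_of_mem _ (hJ s hs), row,
        Finsupp.filter_apply_pos (fun r : ℤ × ℤ => r.2 = s.2) w rfl]
      intro j _ hj
      rw [row, Finsupp.filter_apply_neg (fun r : ℤ × ℤ => r.2 = j) w (Ne.symm hj)]
    · rw [Finsupp.notMem_support_iff] at hs
      rw [hs, Finset.sum_eq_zero]
      intro j _
      rw [row, Finsupp.filter_apply, hs, ite_self]
  conv_lhs => rw [this]
  rw [stepEval_sum]
  exact Finset.sum_congr rfl fun j _ => stepEval_row w j p

/-! ### Fibres of the step polynomial -/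

/-- The largest move in the `Y` direction (`0` if no step has a positive one). -/
def maxY (w : WeightedModel) : ℕ := w.support.sup fun s => s.2.toNat

/-- The largest move in the `X` direction (`0` if no step has a positive one). -/
def maxX (w : WeightedModel) : ℕ := w.support.sup fun s => s.1.toNat

lemma le_maxY {w : WeightedModel} {s : ℤ × ℤ} (hs : s ∈ w.support) : s.2 ≤ maxY w := by
  have := Finset.le_sup (f := fun s : ℤ × ℤ => s.2.toNat) hs
  simp only [maxY] at *
  omega

lemma le_maxX {w : WeightedModel} {s : ℤ × ℤ} (hs : s ∈ w.support) : s.1 ≤ maxX w := by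
  have := Finset.le_sup (f := fun s : ℤ × ℤ => s.1.toNat) hs
  simp only [maxX] at *
  omega

lemma exists_mY {w : WeightedModel} (h : 0 < mY w) : ∃ s ∈ w.support, s.2 = -mY w := by
  have hne : w.support.Nonempty := by
    by_contra hc
    rw [Finset.not_nonempty_iff_eq_empty] at hc
    simp [mY, hc] at h
  obtain ⟨s, hs, h1⟩ := Finset.exists_mem_eq_sup _ hne fun s : ℤ × ℤ => (-s.2).toNat
  refine ⟨s, hs, ?_⟩
  simp only [mY] at *
  omega

lemma exists_maxY {w : WeightedModel} (h : 0 < maxY w) : ∃ s ∈ w.support, s.2 = maxY w := by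
  have hne : w.support.Nonempty := by
    by_contra hc
    rw [Finset.not_nonempty_iff_eq_empty] at hc
    simp [maxY, hc] at h
  obtain ⟨s, hs, h1⟩ := Finset.exists_mem_eq_sup _ hne fun s : ℤ × ℤ => s.2.toNat
  refine ⟨s, hs, ?_⟩
  simp only [maxY] at *
  omega

/-- The polynomial `V ^ m_y (S(u, V) - σ)`. -/
def fibrePoly (w : WeightedModel) (u : KKˣ) (σ : KK) : Polynomial KK :=
  ∑ k ∈ Finset.range (mY w + maxY w + 1),
    Polynomial.C (rowEval w ((k : ℤ) - mY w) u) * Polynomial.X ^ k -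
      Polynomial.C σ * Polynomial.X ^ mY w

lemma coeff_fibrePoly (w : WeightedModel) (u : KKˣ) (σ : KK) (k : ℕ) :
    (fibrePoly w u σ).coeff k =
      rowEval w ((k : ℤ) - mY w) u - if k = mY w then σ else 0 := by
  simp only [fibrePoly, Polynomial.coeff_sub, Polynomial.finsetSum_coeff,
    Polynomial.coeff_C_mul_X_pow]
  congr 1
  rw [Finset.sum_ite_eq, ite_eq_left_iff]
  intro hk
  rw [Finset.mem_range] at hk
  refine (rowEval_eq_zero (fun s hs => ?_) u).symm
  have := le_maxY hs
  omega

lemma natDegree_fibrePoly_le (w : WeightedModel) (u : KKˣ) (σ : KK) :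
    (fibrePoly w u σ).natDegree ≤ mY w + maxY w := by
  rw [Polynomial.natDegree_le_iff_coeff_eq_zero]
  intro k hk
  rw [coeff_fibrePoly, if_neg (by omega), sub_zero]
  refine rowEval_eq_zero (fun s hs => ?_) u
  have := le_maxY hs
  omega

lemma eval_fibrePoly (w : WeightedModel) (p : KKˣ × KKˣ) (σ : KK) :
    (fibrePoly w p.1 σ).eval (p.2 : KK) = (p.2 : KK) ^ mY w * (stepEval w p - σ) := by
  rw [stepEval_eq_sum_rows w ((Finset.range (mY w + maxY w + 1)).image fun k : ℕ => (k : ℤ) - mY w),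
    Finset.sum_image (fun a _ b _ h => by simpa using h), fibrePoly, Polynomial.eval_sub,
    Polynomial.eval_finsetSum, mul_sub, Finset.mul_sum]
  · congr 1
    · refine Finset.sum_congr rfl fun k _ => ?_
      simp only [Polynomial.eval_mul, Polynomial.eval_C, Polynomial.eval_pow, Polynomial.eval_X]
      have : (p.2 : KK) ^ k = p.2 ^ mY w * ((p.2 ^ ((k : ℤ) - mY w) : KKˣ) : KK) := by
        have : p.2 ^ k = p.2 ^ mY w * p.2 ^ ((k : ℤ) - mY w) := by
          rw [zpow_sub, zpow_natCast, zpow_natCast, mul_comm, inv_mul_cancel_right]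
        exact_mod_cast congrArg Units.val this
      rw [this]
      ring
    · rw [Polynomial.eval_mul, Polynomial.eval_C, Polynomial.eval_pow, Polynomial.eval_X, mul_comm]
  · intro s hs
    have := le_maxY hs
    have := neg_le_mY hs
    rw [Finset.mem_image]
    exact ⟨(s.2 + mY w).toNat, by rw [Finset.mem_range]; omega, by omega⟩

/-- A Laurent polynomial in which `Y` occurs takes a value transcendental over `ℂ(u)` at a generic
pair `(u, v)`. -/
lemma Generic.transcendental_stepEval {w : WeightedModel} (hw : ∃ s ∈ w.support, s.2 ≠ 0)
    {p : KKˣ × KKˣ} (hp : Generic p) :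
    Transcendental (IntermediateField.adjoin ℂ {(p.1 : KK)}) (stepEval w p) := by
  intro halg
  obtain ⟨-, hv⟩ := (algebraicIndependent_pair_iff _ _).1 hp
  refine hv ?_
  set E := IntermediateField.adjoin ℂ {(p.1 : KK)}
  -- If S(u,v) lay in the relative algebraic closure L of ℂ(u), then v would be a root of a nonzero
  -- polynomial over L. Since L is algebraically closed in 𝕂, v itself would lie in L.
  set L := algebraicClosure E KK
  have hE : ∀ z : KK, z ∈ E → z ∈ L := fun z hz => L.algebraMap_mem ⟨z, hz⟩
  have hu : (p.1 : KK) ∈ E := IntermediateField.subset_adjoin _ _ rfl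
  have hrow : ∀ j, rowEval w j p.1 ∈ E := by
    intro j
    rw [rowEval, stepEval, Finsupp.sum]
    refine E.sum_mem fun s _ => ?_
    simp only [one_zpow, Units.val_one, mul_one, Units.val_zpow_eq_zpow_val]
    exact E.mul_mem (E.algebraMap_mem _) (zpow_mem hu _)
  have hσ : stepEval w p ∈ L := mem_algebraicClosure_iff.2 halg
  have hlift : fibrePoly w p.1 (stepEval w p) ∈ Polynomial.lifts (algebraMap L KK) := by
    rw [Polynomial.lifts_iff_coeff_lifts]
    intro k
    rw [coeff_fibrePoly]
    have : (rowEval w ((k : ℤ) - mY w) p.1 - if k = mY w then stepEval w p else 0) ∈ L := by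
      refine L.sub_mem (hE _ (hrow _)) ?_
      split_ifs
      · exact hσ
      · exact L.zero_mem
    exact ⟨⟨_, this⟩, rfl⟩
  obtain ⟨Q, hQ⟩ := (Polynomial.mem_lifts _).1 hlift
  have halgL : IsAlgebraic L (p.2 : KK) := by
    refine ⟨Q, ?_, ?_⟩
    · rintro rfl
      obtain ⟨s, hs, hs0⟩ := hw
      have := coeff_fibrePoly w p.1 (stepEval w p) (s.2 + mY w).toNat
      have h1 := neg_le_mY hs
      rw [← hQ, Polynomial.map_zero, Polynomial.coeff_zero, if_neg (by omega), sub_zero,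
        show (((s.2 + mY w).toNat : ℤ) - mY w) = s.2 by omega] at this
      exact rowEval_ne_zero hs hp this.symm
    · rw [Polynomial.aeval_def, Polynomial.eval₂_eq_eval_map, hQ, eval_fibrePoly, sub_self, mul_zero]
  have : (p.2 : KK) ∈ algebraicClosure L KK := mem_algebraicClosure_iff.2 halgL
  rw [algebraicClosure.algebraicClosure_eq_bot, IntermediateField.mem_bot] at this
  obtain ⟨z, hz⟩ := this
  rw [← hz]
  exact mem_algebraicClosure_iff.1 z.2

/-- If the second coordinate of q were algebraic over ℂ(u), so would be S(q) = S(p), which is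
transcendental. -/
lemma Generic.of_stepEval_eq {w : WeightedModel} (hw : ∃ s ∈ w.support, s.2 ≠ 0)
    {p q : KKˣ × KKˣ} (hp : Generic p) (h1 : p.1 = q.1) (h : stepEval w p = stepEval w q) :
    Generic q := by
  refine (algebraicIndependent_pair_iff _ _).2
    ⟨h1 ▸ ((algebraicIndependent_pair_iff _ _).1 hp).1, fun halg => ?_⟩
  refine (h ▸ hp.transcendental_stepEval hw) ?_
  rw [h1]
  set E := IntermediateField.adjoin ℂ {(q.1 : KK)}
  set L := algebraicClosure E KK
  have hu : (q.1 : KK) ∈ L := L.algebraMap_mem ⟨_, IntermediateField.subset_adjoin _ _ rfl⟩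
  have hv : (q.2 : KK) ∈ L := mem_algebraicClosure_iff.2 halg
  refine mem_algebraicClosure_iff.1 (?_ : _ ∈ L)
  rw [stepEval, Finsupp.sum]
  refine L.sum_mem fun s _ => ?_
  simp only [Units.val_zpow_eq_zpow_val]
  exact L.mul_mem (L.mul_mem (L.algebraMap_mem (algebraMap ℂ E _)) (zpow_mem hu _))
    (zpow_mem hv _)

/-- The polynomial `V ^ m_y (S(u, V) - σ)` has simple nonzero roots only. -/
lemma Generic.eval_derivative_fibrePoly_ne_zero {w : WeightedModel}
    (hw : ∃ s ∈ w.support, s.2 ≠ 0) {p : KKˣ × KKˣ} (hp : Generic p) :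
    (Polynomial.derivative (fibrePoly w p.1 (stepEval w p))).eval (p.2 : KK) ≠ 0 := by
  -- This is the model of Y ∂S/∂Y, nonzero because Y occurs in S. At a root v, the derivative of the
  -- fibre polynomial times v equals v ^ m_y times its value.
  set w' : WeightedModel := Finsupp.onFinset w.support (fun s => (s.2 : ℂ) * w s)
    (fun s hs => Finsupp.mem_support_iff.2 fun h => hs (by simp [h])) with hw'
  have hw'0 : w' ≠ 0 := by
    obtain ⟨s, hs, hs0⟩ := hw
    intro h
    have := DFunLike.congr_fun h s
    simp only [hw', Finsupp.onFinset_apply, Finsupp.coe_zero, Pi.zero_apply, mul_eq_zero,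
      Int.cast_eq_zero] at this
    exact this.elim hs0 (Finsupp.mem_support_iff.1 hs)
  have hsupp : w'.support ⊆ w.support := Finsupp.support_onFinset_subset
  have hr : ∀ j, rowEval w' j p.1 = (j : KK) * rowEval w j p.1 := by
    intro j
    unfold rowEval stepEval
    rw [Finsupp.sum_of_support_subset (s := (row w j).support), Finsupp.sum, Finset.mul_sum]
    · refine Finset.sum_congr rfl fun s hs => ?_
      have h2 : s.2 = j := by
        rw [row, Finsupp.support_filter, Finset.mem_filter] at hs
        exact hs.2
      simp only [row]
      rw [Finsupp.filter_apply_pos (fun r : ℤ × ℤ => r.2 = j) w' h2,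
        Finsupp.filter_apply_pos (fun r : ℤ × ℤ => r.2 = j) w h2]
      simp only [hw', Finsupp.onFinset_apply, map_mul, map_intCast, h2]
      ring
    · intro s
      simp only [row, Finsupp.support_filter, Finset.mem_filter]
      exact fun h => ⟨hsupp h.1, h.2⟩
    · simp
  have key : (p.2 : KK) * (Polynomial.derivative (fibrePoly w p.1 (stepEval w p))).eval (p.2 : KK) =
      p.2 ^ mY w * stepEval w' p + mY w * (fibrePoly w p.1 (stepEval w p)).eval (p.2 : KK) := by
    have hJ : ∀ s ∈ w.support, s.2 ∈
        (Finset.range (mY w + maxY w + 1)).image fun k : ℕ => (k : ℤ) - mY w := by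
      intro s hs
      have := le_maxY hs
      have := neg_le_mY hs
      rw [Finset.mem_image]
      exact ⟨(s.2 + mY w).toNat, by rw [Finset.mem_range]; omega, by omega⟩
    rw [stepEval_eq_sum_rows w' _ fun s hs => hJ s (hsupp hs),
      Finset.sum_image (fun a _ b _ h => by simpa using h)]
    simp only [fibrePoly, Polynomial.derivative_sub, Polynomial.derivative_sum,
      Polynomial.eval_sub, Polynomial.eval_finsetSum, Polynomial.derivative_C_mul_X_pow, mul_sub,
      Finset.mul_sum, Polynomial.eval_mul, Polynomial.eval_C, Polynomial.eval_pow,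
      Polynomial.eval_X]
    rw [add_sub, ← Finset.sum_add_distrib]
    have hpow : ∀ k : ℕ, (p.2 : KK) * (k * (p.2 : KK) ^ (k - 1)) = k * (p.2 : KK) ^ k := by
      rintro (_ | k)
      · simp
      · rw [Nat.add_sub_cancel, pow_succ]
        ring
    congr 1
    · refine Finset.sum_congr rfl fun k _ => ?_
      have : (p.2 : KK) ^ k = p.2 ^ mY w * ((p.2 ^ ((k : ℤ) - mY w) : KKˣ) : KK) := by
        have : p.2 ^ k = p.2 ^ mY w * p.2 ^ ((k : ℤ) - mY w) := by
          rw [zpow_sub, zpow_natCast, zpow_natCast, mul_comm, inv_mul_cancel_right]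
        exact_mod_cast congrArg Units.val this
      rw [hr, mul_assoc, mul_left_comm, hpow, this]
      push_cast
      ring
    · rw [mul_assoc, mul_left_comm, hpow]
      ring
  intro h
  rw [h, mul_zero, eval_fibrePoly, sub_self, mul_zero, mul_zero, add_zero] at key
  exact mul_ne_zero (pow_ne_zero _ p.2.ne_zero) (stepEval_ne_zero hw'0 hp) key.symm

/-- The fibre of a generic point has as many elements as the degree of the kernel polynomial
predicts. -/
lemma Generic.exists_fibre {w : WeightedModel} (hw : ∃ s ∈ w.support, s.2 ≠ 0)
    {p : KKˣ × KKˣ} (hp : Generic p) :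
    ∃ T : Finset KKˣ, T.card = mY w + maxY w ∧ ∀ v ∈ T, stepEval w (p.1, v) = stepEval w p := by
  classical
  set P := fibrePoly w p.1 (stepEval w p) with hP
  -- This coefficient, from which σ is subtracted, is the constant one when m_y = 0 and the leading
  -- one when no step goes up.
  have hmid : P.coeff (mY w) ≠ 0 := by
    rw [coeff_fibrePoly, if_pos rfl, sub_self, sub_ne_zero]
    intro h
    have h1 : row w 0 - w ≠ 0 := by
      obtain ⟨s, hs, hs0⟩ := hw
      intro h
      have := DFunLike.congr_fun h s
      rw [Finsupp.sub_apply, row, Finsupp.filter_apply_neg (fun r : ℤ × ℤ => r.2 = 0) w hs0,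
        zero_sub] at this
      exact Finsupp.mem_support_iff.1 hs (neg_eq_zero.1 this)
    refine stepEval_ne_zero h1 hp ?_
    rw [stepEval_sub, stepEval_row, ← h]
    simp
  have hlead : P.coeff (mY w + maxY w) ≠ 0 := by
    rcases Nat.eq_zero_or_pos (maxY w) with h | h
    · rw [h]
      exact hmid
    · obtain ⟨s, hs, hs1⟩ := exists_maxY h
      rw [coeff_fibrePoly, if_neg (by omega), sub_zero,
        show (((mY w + maxY w : ℕ) : ℤ) - mY w) = s.2 by push_cast; omega]
      exact rowEval_ne_zero hs hp
  have hconst : P.coeff 0 ≠ 0 := by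
    rcases Nat.eq_zero_or_pos (mY w) with h | h
    · rw [h] at hmid
      exact hmid
    · obtain ⟨s, hs, hs1⟩ := exists_mY h
      rw [coeff_fibrePoly, if_neg (by omega), sub_zero,
        show (((0 : ℕ) : ℤ) - mY w) = s.2 by push_cast; omega]
      exact rowEval_ne_zero hs hp
  have hP0 : P ≠ 0 := fun h => hlead (by rw [h, Polynomial.coeff_zero])
  have hdeg : P.natDegree = mY w + maxY w :=
    le_antisymm (natDegree_fibrePoly_le _ _ _) (Polynomial.le_natDegree_of_ne_zero hlead)
  have hne : ∀ v ∈ P.roots, v ≠ 0 := by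
    rintro v hv rfl
    rw [Polynomial.mem_roots hP0, Polynomial.IsRoot, ← Polynomial.coeff_zero_eq_eval_zero] at hv
    exact hconst hv
  have hval : ∀ v : KKˣ, (v : KK) ∈ P.roots → stepEval w (p.1, v) = stepEval w p := by
    intro v hv
    rw [Polynomial.mem_roots hP0, Polynomial.IsRoot, hP, eval_fibrePoly w (p.1, v)] at hv
    exact sub_eq_zero.1 ((mul_eq_zero.1 hv).resolve_left (pow_ne_zero _ v.ne_zero))
  have hnodup : P.roots.Nodup := by
    rw [Multiset.nodup_iff_count_le_one]
    intro v
    rw [Polynomial.count_roots]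
    by_contra hc
    rw [not_le] at hc
    obtain ⟨h1, h2⟩ := (Polynomial.one_lt_rootMultiplicity_iff_isRoot hP0).1 hc
    -- A multiple root would again give a generic pair in the same fibre, where the derivative
    -- cannot vanish.
    have hv0 : v ∈ P.roots := (Polynomial.mem_roots hP0).2 h1
    have h3 := hval (Units.mk0 v (hne v hv0)) hv0
    have h4 := (hp.of_stepEval_eq hw (q := (p.1, Units.mk0 v (hne v hv0))) rfl
      h3.symm).eval_derivative_fibrePoly_ne_zero hw
    rw [h3] at h4
    exact h4 h2
  refine ⟨P.roots.toFinset.attach.image fun v => Units.mk0 v.1 (hne v.1 (Multiset.mem_toFinset.1 v.2)),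
    ?_, ?_⟩
  · rw [Finset.card_image_of_injective, Finset.card_attach, Multiset.toFinset_card_of_nodup hnodup,
      ← hdeg]
    · exact (IsAlgClosed.splits P).natDegree_eq_card_roots.symm
    · intro a b h
      exact Subtype.ext (congrArg Units.val h)
  · intro v hv
    rw [Finset.mem_image] at hv
    obtain ⟨z, -, rfl⟩ := hv
    exact hval _ (Multiset.mem_toFinset.1 z.2)

/-! ### Genericity of the orbit -/

lemma exists_support_transpose {w : WeightedModel} (hw : ∃ s ∈ w.support, s.1 ≠ 0) :
    ∃ s ∈ (transpose w).support, s.2 ≠ 0 := by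
  obtain ⟨s, hs, hs0⟩ := hw
  exact ⟨s.swap, mem_support_transpose.2 (by rwa [Prod.swap_swap]), hs0⟩

lemma generic_of_mem_orbit {w : WeightedModel} (hw : IsNotUnivariate w) {p : KKˣ × KKˣ}
    (hp : p ∈ Orbit w) : Generic p := by
  induction hp with
  | refl => exact generic_xK_yK
  | @tail q r _ h ih =>
    rcases h with ⟨h1, h2⟩ | ⟨h1, h2⟩
    · exact ih.of_stepEval_eq hw.2 h1 h2
    · refine (ih.swap.of_stepEval_eq (q := r.swap) (exists_support_transpose hw.1) h1 ?_).swap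
      rw [stepEval_transpose, stepEval_transpose, h2]

lemma stepEval_of_mem_orbit {w : WeightedModel} {p : KKˣ × KKˣ} (hp : p ∈ Orbit w) :
    stepEval w p = stepEval w (xK, yK) := by
  induction hp with
  | refl => rfl
  | tail _ h ih => exact (h.elim And.right And.right).symm.trans ih

lemma mY_transpose (w : WeightedModel) : mY (transpose w) = mX w := by
  refine le_antisymm (Finset.sup_le fun s hs => ?_) (Finset.sup_le fun s hs => ?_)
  · exact Finset.le_sup (f := fun s : ℤ × ℤ => (-s.1).toNat) (mem_support_transpose.1 hs)
  · exact Finset.le_sup (f := fun s : ℤ × ℤ => (-s.2).toNat)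
      ((mem_support_transpose (s := s.swap)).2 (by rwa [Prod.swap_swap]))

lemma maxY_transpose (w : WeightedModel) : maxY (transpose w) = maxX w := by
  refine le_antisymm (Finset.sup_le fun s hs => ?_) (Finset.sup_le fun s hs => ?_)
  · exact Finset.le_sup (f := fun s : ℤ × ℤ => s.1.toNat) (mem_support_transpose.1 hs)
  · exact Finset.le_sup (f := fun s : ℤ × ℤ => s.2.toNat)
      ((mem_support_transpose (s := s.swap)).2 (by rwa [Prod.swap_swap]))

lemma Generic.exists_fibre' {w : WeightedModel} (hw : ∃ s ∈ w.support, s.1 ≠ 0)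
    {p : KKˣ × KKˣ} (hp : Generic p) :
    ∃ T : Finset KKˣ, T.card = mX w + maxX w ∧ ∀ u ∈ T, stepEval w (u, p.2) = stepEval w p := by
  obtain ⟨T, hT, h⟩ := hp.swap.exists_fibre (exists_support_transpose hw)
  refine ⟨T, by rw [hT, mY_transpose, maxY_transpose], fun u hu => ?_⟩
  have := h u hu
  rwa [stepEval_transpose, show (p.swap.1, u) = (u, p.2).swap from rfl, stepEval_transpose] at this

/-! ### Evaluating fractions on the orbit -/

lemma kernelPoly_eq (w : WeightedModel) :
    kernelPoly w = X 0 ^ mX w * X 1 ^ mY w - X 2 * numPoly (Fin 3) 0 1 w := rfl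

lemma exists_mX {w : WeightedModel} (h : 0 < mX w) : ∃ s ∈ w.support, s.1 = -mX w := by
  rw [← mY_transpose] at h
  obtain ⟨s, hs, h1⟩ := exists_mY h
  exact ⟨s.swap, mem_support_transpose.1 hs, by rw [← mY_transpose]; exact h1⟩

lemma not_X_dvd_of_coeff_ne_zero {ι : Type*} {i : ι} {P : MvPolynomial ι ℂ} {m : ι →₀ ℕ}
    (hm : m i = 0) (h : coeff m P ≠ 0) : ¬ X i ∣ P := by
  classical
  rintro ⟨Q, rfl⟩
  rw [coeff_X_mul', if_neg (by simpa using hm)] at h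
  exact h rfl

/-- A common divisor divides X ^ m_x Y ^ m_y. By minimality of m_x and m_y, the numerator of S is
not divisible by X when m_x > 0, nor by Y when m_y > 0. -/
lemma isRelPrime_kernelPoly_numPoly (w : WeightedModel) :
    IsRelPrime (kernelPoly w) (numPoly (Fin 3) 0 1 w) := by
  have h0 : IsRelPrime ((X 0 : Poly3) ^ mX w) (numPoly (Fin 3) 0 1 w) := by
    rcases Nat.eq_zero_or_pos (mX w) with h | h
    · rw [h, pow_zero]
      exact isRelPrime_one_left
    · refine IsRelPrime.pow_left ((X_prime (i := (0 : Fin 3))).irreducible.isRelPrime_iff_not_dvd.2 ?_)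
      obtain ⟨s, hs, h1⟩ := exists_mX h
      refine not_X_dvd_of_coeff_ne_zero (m := _) ?_
        ((coeff_numPoly (σ := Fin 3) (i := 0) (j := 1) (by decide) w hs).trans_ne
          (Finsupp.mem_support_iff.1 hs))
      simp [h1]
  have h1 : IsRelPrime ((X 1 : Poly3) ^ mY w) (numPoly (Fin 3) 0 1 w) := by
    rcases Nat.eq_zero_or_pos (mY w) with h | h
    · rw [h, pow_zero]
      exact isRelPrime_one_left
    · refine IsRelPrime.pow_left ((X_prime (i := (1 : Fin 3))).irreducible.isRelPrime_iff_not_dvd.2 ?_)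
      obtain ⟨s, hs, h1⟩ := exists_mY h
      refine not_X_dvd_of_coeff_ne_zero (m := _) ?_
        ((coeff_numPoly (σ := Fin 3) (i := 0) (j := 1) (by decide) w hs).trans_ne
          (Finsupp.mem_support_iff.1 hs))
      simp [h1]
  intro d hd hN
  refine IsRelPrime.mul_left h0 h1 ?_ hN
  rw [kernelPoly_eq] at hd
  exact (dvd_sub_left (hN.mul_left _)).1 hd

/-- Evaluation of a polynomial in `X, Y, t` at `(u, v, τ)`. -/
def evalAt (p : KKˣ × KKˣ) (τ : KK) : Poly3 →ₐ[ℂ] KK := aeval ![(p.1 : KK), p.2, τ]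

lemma evalAt_kernelPoly (w : WeightedModel) (p : KKˣ × KKˣ) (h : stepEval w p ≠ 0) :
    evalAt p (stepEval w p)⁻¹ (kernelPoly w) = 0 := by
  rw [kernelPoly_eq, map_sub, map_mul, map_mul, map_pow, map_pow]
  unfold evalAt
  rw [aeval_numPoly 0 1 w ![(p.1 : KK), p.2, (stepEval w p)⁻¹] p rfl rfl]
  simp only [aeval_X, Matrix.cons_val]
  field_simp
  ring

/-- The kernel is linear in t: modulo it, t times the numerator N of S is X ^ m_x Y ^ m_y.
Multiplying by a power of N thus eliminates t. -/
lemma exists_pseudoDivision (w : WeightedModel) (B : Poly3) :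
    ∃ (n : ℕ) (B' : MvPolynomial (Fin 2) ℂ) (Q : Poly3),
      numPoly (Fin 3) 0 1 w ^ n * B = rename Fin.castSucc B' + kernelPoly w * Q := by
  have hN : rename Fin.castSucc (numPoly (Fin 2) 0 1 w) = numPoly (Fin 3) 0 1 w := by
    simp only [numPoly, Finsupp.sum, map_sum, map_mul, map_pow, rename_X, rename_C]
    rfl
  induction B using MvPolynomial.induction_on with
  | C a => exact ⟨0, C a, 0, by rw [rename_C]; ring⟩
  | add p q hp hq =>
    obtain ⟨n, P, Q, h⟩ := hp
    obtain ⟨n', P', Q', h'⟩ := hq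
    refine ⟨n + n', numPoly (Fin 2) 0 1 w ^ n' * P + numPoly (Fin 2) 0 1 w ^ n * P',
      numPoly (Fin 3) 0 1 w ^ n' * Q + numPoly (Fin 3) 0 1 w ^ n * Q', ?_⟩
    simp only [map_add, map_mul, map_pow, hN]
    linear_combination numPoly (Fin 3) 0 1 w ^ n' * h + numPoly (Fin 3) 0 1 w ^ n * h'
  | mul_X p i hp =>
    obtain ⟨n, P, Q, h⟩ := hp
    by_cases hi : i = 2
    · subst hi
      refine ⟨n + 1, P * (X 0 ^ mX w * X 1 ^ mY w),
        Q * (X 0 ^ mX w * X 1 ^ mY w) - (rename Fin.castSucc P + kernelPoly w * Q), ?_⟩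
      simp only [map_mul, map_pow, rename_X]
      rw [show (Fin.castSucc (0 : Fin 2)) = 0 from rfl, show (Fin.castSucc (1 : Fin 2)) = 1 from rfl]
      have hk := kernelPoly_eq w
      linear_combination X 2 * numPoly (Fin 3) 0 1 w * h +
        (rename Fin.castSucc P + kernelPoly w * Q) * hk
    · obtain ⟨j, rfl⟩ : ∃ j : Fin 2, Fin.castSucc j = i := Fin.exists_castSucc_eq.2 hi
      refine ⟨n, P * X j, Q * X (Fin.castSucc j), ?_⟩
      rw [map_mul, rename_X]
      linear_combination X (Fin.castSucc j) * h

/-- The remainder of the pseudo-division involves X and Y only and vanishes at the independent pair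
p, so it is zero. The power of the numerator can then be cancelled, being coprime to the kernel. -/
lemma Generic.kernelPoly_dvd {w : WeightedModel} (hw : w ≠ 0) {p : KKˣ × KKˣ} (hp : Generic p)
    {B : Poly3} (hB : evalAt p (stepEval w p)⁻¹ B = 0) : kernelPoly w ∣ B := by
  obtain ⟨n, B', Q, h⟩ := exists_pseudoDivision w B
  have h1 := congrArg (evalAt p (stepEval w p)⁻¹) h
  rw [map_mul, hB, mul_zero, map_add, map_mul, evalAt_kernelPoly w p (stepEval_ne_zero hw hp),
    zero_mul, add_zero, evalAt, aeval_rename] at h1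
  have h2 : (![(p.1 : KK), p.2, (stepEval w p)⁻¹] ∘ Fin.castSucc : Fin 2 → KK) =
      ![(p.1 : KK), p.2] := by
    ext i
    fin_cases i <;> rfl
  rw [h2] at h1
  rw [(algebraicIndependent_iff.1 hp) B' h1.symm, map_zero, zero_add] at h
  exact (isRelPrime_kernelPoly_numPoly w).pow_right.dvd_of_dvd_mul_left ⟨Q, h⟩

lemma Generic.algebraicIndependent_inv_stepEval {w : WeightedModel}
    (hw : ∃ s ∈ w.support, s.2 ≠ 0) {p : KKˣ × KKˣ} (hp : Generic p) :
    AlgebraicIndependent ℂ ![(p.1 : KK), (stepEval w p)⁻¹] := by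
  refine (algebraicIndependent_pair_iff _ _).2 ⟨((algebraicIndependent_pair_iff _ _).1 hp).1, ?_⟩
  intro h
  exact hp.transcendental_stepEval hw (by simpa using h.inv)

lemma exists_polynomials_of_mem_adjoin {a : Fin 2 → Fin 3} {H : Frac3}
    (hH : H ∈ IntermediateField.adjoin ℂ (Set.range fun i => algebraMap Poly3 Frac3 (X (a i)))) :
    ∃ P Q : MvPolynomial (Fin 2) ℂ, Q ≠ 0 ∧
      H * algebraMap Poly3 Frac3 (rename a Q) = algebraMap Poly3 Frac3 (rename a P) := by
  have hev : ∀ P : MvPolynomial (Fin 2) ℂ,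
      aeval (fun i => algebraMap Poly3 Frac3 (X (a i))) P = algebraMap Poly3 Frac3 (rename a P) := by
    intro P
    have : aeval (fun i => algebraMap Poly3 Frac3 (X (a i))) =
        (IsScalarTower.toAlgHom ℂ Poly3 Frac3).comp (rename a) := by
      ext i
      simp
    rw [this]
    rfl
  obtain ⟨P, Q, h⟩ := (IntermediateField.mem_adjoin_range_iff ℂ _ _).1 hH
  rw [hev, hev] at h
  -- A zero denominator makes the quotient 0 by convention; the presentation 0/1 replaces it.
  by_cases hQ : algebraMap Poly3 Frac3 (rename a Q) = 0
  · exact ⟨0, 1, one_ne_zero, by rw [h, hQ, div_zero, zero_mul, map_zero, map_zero]⟩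
  · refine ⟨P, Q, ?_, by rw [h, div_mul_cancel₀ _ hQ]⟩
    rintro rfl
    exact hQ (by rw [map_zero, map_zero])

/-- On the orbit, a Galois decoupling of `XY` separates the variables. -/
lemma exists_decoupling_on_orbit {w : WeightedModel} (hw : IsNotUnivariate w)
    (h : HasGaloisDecoupling w (fX * fY)) :
    ∃ F G : KKˣ → KK, ∀ p ∈ Orbit w, (p.1 : KK) * p.2 = F p.1 + G p.2 := by
  obtain ⟨F, hF, G, hG, R, ⟨A, B, hB0, -, rfl, hB⟩, h⟩ := h
  have hF' : F ∈ IntermediateField.adjoin ℂ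
      (Set.range fun i => algebraMap Poly3 Frac3 (X ((![0, 2] : Fin 2 → Fin 3) i))) := by
    have hr : Set.range (fun i => algebraMap Poly3 Frac3 (X ((![0, 2] : Fin 2 → Fin 3) i))) = {fX, ft} := by
      ext z
      simp [Fin.exists_fin_two, fX, ft, eq_comm]
    rw [hr]
    exact hF
  have hG' : G ∈ IntermediateField.adjoin ℂ
      (Set.range fun i => algebraMap Poly3 Frac3 (X ((![1, 2] : Fin 2 → Fin 3) i))) := by
    have hr : Set.range (fun i => algebraMap Poly3 Frac3 (X ((![1, 2] : Fin 2 → Fin 3) i))) = {fY, ft} := by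
      ext z
      simp [Fin.exists_fin_two, fY, ft, eq_comm]
    rw [hr]
    exact hG
  obtain ⟨F₁, F₂, hF₂, hF₁⟩ := exists_polynomials_of_mem_adjoin hF'
  obtain ⟨G₁, G₂, hG₂, hG₁⟩ := exists_polynomials_of_mem_adjoin hG'
  -- Denominators are cleared first, since only polynomials can be evaluated at a point of the
  -- orbit.
  have hpoly : X 0 * X 1 * rename ![0, 2] F₂ * rename ![1, 2] G₂ * B =
      rename ![0, 2] F₁ * rename ![1, 2] G₂ * B + rename ![1, 2] G₁ * rename ![0, 2] F₂ * B +
        kernelPoly w * A * rename ![0, 2] F₂ * rename ![1, 2] G₂ := by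
    apply IsFractionRing.injective Poly3 Frac3
    have hBne : algebraMap Poly3 Frac3 B ≠ 0 := by
      rwa [Ne, map_eq_zero_iff _ (IsFractionRing.injective Poly3 Frac3)]
    simp only [map_mul, map_add, ← hF₁, ← hG₁]
    rw [fX, fY] at h
    rw [h]
    field_simp
  -- S is constant on the orbit, so a single τ serves all its points and the two functions depend on
  -- one coordinate each.
  set τ : KK := (stepEval w (xK, yK))⁻¹
  refine ⟨fun u => aeval ![(u : KK), τ] F₁ / aeval ![(u : KK), τ] F₂,
    fun v => aeval ![(v : KK), τ] G₁ / aeval ![(v : KK), τ] G₂, fun p hp => ?_⟩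
  have hgen := generic_of_mem_orbit hw hp
  have hτ : τ = (stepEval w p)⁻¹ := by rw [stepEval_of_mem_orbit hp]
  have hw0 : w ≠ 0 := by
    rintro rfl
    obtain ⟨⟨s, hs, -⟩, -⟩ := hw
    simp at hs
  have hevX : ∀ P, evalAt p τ (rename ![0, 2] P) = aeval ![(p.1 : KK), τ] P := by
    intro P
    rw [evalAt, aeval_rename]
    congr 2
    ext i
    fin_cases i <;> rfl
  have hevY : ∀ P, evalAt p τ (rename ![1, 2] P) = aeval ![(p.2 : KK), τ] P := by
    intro P
    rw [evalAt, aeval_rename]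
    congr 2
    ext i
    fin_cases i <;> rfl
  -- The three denominators survive: B by regularity, the others because (u,τ) and (v,τ) are
  -- algebraically independent pairs.
  have hBne : evalAt p τ B ≠ 0 := fun h0 => hB (hgen.kernelPoly_dvd hw0 (by rwa [← hτ]))
  have hF₂ne : aeval ![(p.1 : KK), τ] F₂ ≠ 0 := fun h0 => hF₂
    (algebraicIndependent_iff.1 (hτ ▸ hgen.algebraicIndependent_inv_stepEval hw.2) _ h0)
  have hG₂ne : aeval ![(p.2 : KK), τ] G₂ ≠ 0 := fun h0 => hG₂
    (algebraicIndependent_iff.1 (by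
      have := hgen.swap.algebraicIndependent_inv_stepEval (exists_support_transpose hw.1)
      rwa [stepEval_transpose, ← hτ] at this) _ h0)
  have hK : evalAt p τ (kernelPoly w) = 0 := by
    rw [hτ]
    exact evalAt_kernelPoly w p (stepEval_ne_zero hw0 hgen)
  have hev := congrArg (evalAt p τ) hpoly
  simp only [map_mul, map_add, hevX, hevY, hK, zero_mul, add_zero] at hev
  rw [show evalAt p τ (X 0) = p.1 by simp [evalAt], show evalAt p τ (X 1) = p.2 by simp [evalAt]]
    at hev
  field_simp
  refine mul_right_cancel₀ hBne ?_
  linear_combination hev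

/-! ### Induced squares in the orbit -/

/-- The graph contains an induced cycle of length `4`. -/
def HasInducedSquare {V : Type*} (Γ : SimpleGraph V) : Prop :=
  ∃ a b c d : V, Γ.Adj a b ∧ Γ.Adj b c ∧ Γ.Adj c d ∧ Γ.Adj d a ∧
    a ≠ c ∧ b ≠ d ∧ ¬ Γ.Adj a c ∧ ¬ Γ.Adj b d

lemma HasInducedSquare.of_iso {V W : Type*} {Γ : SimpleGraph V} {Γ' : SimpleGraph W}
    (h : HasInducedSquare Γ) (e : Γ' ≃g Γ) : HasInducedSquare Γ' := by
  obtain ⟨a, b, c, d, h1, h2, h3, h4, h5, h6, h7, h8⟩ := h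
  exact ⟨e.symm a, e.symm b, e.symm c, e.symm d, e.symm.map_adj_iff.2 h1, e.symm.map_adj_iff.2 h2,
    e.symm.map_adj_iff.2 h3, e.symm.map_adj_iff.2 h4, e.symm.injective.ne h5, e.symm.injective.ne h6,
    fun h => h7 (e.symm.map_adj_iff.1 h), fun h => h8 (e.symm.map_adj_iff.1 h)⟩

lemma orbitGraph_adj {w : WeightedModel} {p q : Orbit w} :
    (orbitGraph w).Adj p q ↔ p ≠ q ∧ (p.1.1 = q.1.1 ∨ p.1.2 = q.1.2) := by
  have h : stepEval w p.1 = stepEval w q.1 :=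
    (stepEval_of_mem_orbit p.2).trans (stepEval_of_mem_orbit q.2).symm
  simp only [orbitGraph, SimpleGraph.fromRel_adj, Adjacent, XAdjacent, YAdjacent, h, and_true,
    eq_comm (a := q.1.1), eq_comm (a := q.1.2), or_self]

lemma mem_orbit_of_fst_eq {w : WeightedModel} {p q : KKˣ × KKˣ} (hp : p ∈ Orbit w)
    (h : p.1 = q.1) (hs : stepEval w q = stepEval w p) : q ∈ Orbit w :=
  Relation.ReflTransGen.tail hp (Or.inl ⟨h, hs.symm⟩)

lemma mem_orbit_of_snd_eq {w : WeightedModel} {p q : KKˣ × KKˣ} (hp : p ∈ Orbit w)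
    (h : p.2 = q.2) (hs : stepEval w q = stepEval w p) : q ∈ Orbit w :=
  Relation.ReflTransGen.tail hp (Or.inr ⟨h, hs.symm⟩)

lemma xK_yK_mem_orbit (w : WeightedModel) : (xK, yK) ∈ Orbit w := Relation.ReflTransGen.refl

/-- The alternating sum of uv = F(u) + G(v) around the square cancels F and G and leaves
(u-u')(v-v') = 0. -/
lemma not_hasGaloisDecoupling_of_square {w : WeightedModel} (hw : IsNotUnivariate w)
    {u u' v v' : KKˣ} (hu : u ≠ u') (hv : v ≠ v') (h1 : (u, v) ∈ Orbit w) (h2 : (u, v') ∈ Orbit w)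
    (h3 : (u', v') ∈ Orbit w) (h4 : (u', v) ∈ Orbit w) :
    ¬ HasGaloisDecoupling w (fX * fY) := by
  intro h
  obtain ⟨F, G, hFG⟩ := exists_decoupling_on_orbit hw h
  have e1 := hFG _ h1
  have e2 := hFG _ h2
  have e3 := hFG _ h3
  have e4 := hFG _ h4
  have : ((u : KK) - u') * ((v : KK) - v') = 0 := by
    simp only at e1 e2 e3 e4
    linear_combination e1 - e2 + e3 - e4
  rcases mul_eq_zero.1 this with h | h
  · exact hu (Units.ext (sub_eq_zero.1 h))
  · exact hv (Units.ext (sub_eq_zero.1 h))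

/-- Opposite vertices are not adjacent, so they share no coordinate. The coordinates shared along
the four edges must therefore alternate, and the cycle is a product of two pairs. -/
lemma not_hasGaloisDecoupling_of_hasInducedSquare {w : WeightedModel} (hw : IsNotUnivariate w)
    (h : HasInducedSquare (orbitGraph w)) : ¬ HasGaloisDecoupling w (fX * fY) := by
  obtain ⟨⟨⟨a1, a2⟩, ha⟩, ⟨⟨b1, b2⟩, hb⟩, ⟨⟨c1, c2⟩, hc⟩, ⟨⟨d1, d2⟩, hd⟩,
    h1, h2, h3, h4, h5, h6, h7, h8⟩ := h
  rw [orbitGraph_adj] at h1 h2 h3 h4 h7 h8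
  simp only [ne_eq, Subtype.mk.injEq, Prod.mk.injEq, not_and, not_or] at h1 h2 h3 h4 h5 h6 h7 h8
  have h7' := h7 h5
  have h8' := h8 h6
  rcases h1.2 with rfl | rfl
  · obtain rfl : b2 = c2 := h2.2.resolve_left h7'.1
    obtain rfl : c1 = d1 := h3.2.resolve_right h8'.2
    obtain rfl : d2 = a2 := h4.2.resolve_left (Ne.symm h7'.1)
    exact not_hasGaloisDecoupling_of_square hw h7'.1 h7'.2 ha hb hc hd
  · obtain rfl : b1 = c1 := h2.2.resolve_right h7'.2
    obtain rfl : c2 = d2 := h3.2.resolve_left h8'.1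
    obtain rfl : d1 = a1 := h4.2.resolve_right (Ne.symm h7'.2)
    exact not_hasGaloisDecoupling_of_square hw h7'.1 h7'.2 ha hd hc hb

/-- The product {0,1} × {2,3} avoids the diagonal. -/
lemma hasInducedSquare_O12tilde : HasInducedSquare O12tilde := by
  refine ⟨⟨(0, 2), by decide⟩, ⟨(0, 3), by decide⟩, ⟨(1, 3), by decide⟩, ⟨(1, 2), by decide⟩, ?_⟩
  simp [O12tilde, SimpleGraph.fromRel_adj]

/-! ### Hadamard models -/

lemma exists_maxX {w : WeightedModel} (h : 0 < maxX w) : ∃ s ∈ w.support, s.1 = maxX w := by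
  rw [← maxY_transpose] at h
  obtain ⟨s, hs, h1⟩ := exists_maxY h
  exact ⟨s.swap, mem_support_transpose.1 hs, by rw [← maxY_transpose]; exact h1⟩

/-- Converts the degree condition on Hadamard models into a lower bound on the size of fibres. -/
lemma degreeOf_zero_kernelPoly_le (w : WeightedModel) :
    (kernelPoly w).degreeOf 0 ≤ mX w + maxX w := by
  rw [kernelPoly_eq]
  refine (degreeOf_sub_le _ _ _).trans (max_le ?_ ?_)
  · refine (degreeOf_mul_le _ _ _).trans ?_
    have h1 := degreeOf_pow_le (0 : Fin 3) (X 0 : Poly3) (mX w)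
    have h2 := degreeOf_pow_le (0 : Fin 3) (X 1 : Poly3) (mY w)
    rw [degreeOf_X, if_pos rfl] at h1
    rw [degreeOf_X, if_neg (by decide)] at h2
    omega
  · refine (degreeOf_mul_le _ _ _).trans ?_
    rw [degreeOf_X, if_neg (by decide), zero_add, numPoly, Finsupp.sum]
    refine (degreeOf_sum_le _ _ _).trans (Finset.sup_le fun s hs => ?_)
    refine (degreeOf_mul_le _ _ _).trans ?_
    have h0 := degreeOf_C_mul_le ((X 0 : Poly3) ^ (s.1 + mX w).toNat) (0 : Fin 3) (w s)
    have h1 := degreeOf_pow_le (0 : Fin 3) (X 0 : Poly3) (s.1 + mX w).toNat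
    have h2 := degreeOf_pow_le (0 : Fin 3) (X 1 : Poly3) (s.2 + mY w).toNat
    rw [degreeOf_X, if_pos rfl] at h1
    rw [degreeOf_X, if_neg (by decide)] at h2
    have := le_maxX hs
    have := neg_le_mX hs
    omega

lemma degreeOf_one_kernelPoly_le (w : WeightedModel) :
    (kernelPoly w).degreeOf 1 ≤ mY w + maxY w := by
  rw [kernelPoly_eq]
  refine (degreeOf_sub_le _ _ _).trans (max_le ?_ ?_)
  · refine (degreeOf_mul_le _ _ _).trans ?_
    have h1 := degreeOf_pow_le (1 : Fin 3) (X 0 : Poly3) (mX w)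
    have h2 := degreeOf_pow_le (1 : Fin 3) (X 1 : Poly3) (mY w)
    rw [degreeOf_X, if_neg (by decide)] at h1
    rw [degreeOf_X, if_pos rfl] at h2
    omega
  · refine (degreeOf_mul_le _ _ _).trans ?_
    rw [degreeOf_X, if_neg (by decide), zero_add, numPoly, Finsupp.sum]
    refine (degreeOf_sum_le _ _ _).trans (Finset.sup_le fun s hs => ?_)
    refine (degreeOf_mul_le _ _ _).trans ?_
    have h0 := degreeOf_C_mul_le ((X 0 : Poly3) ^ (s.1 + mX w).toNat) (1 : Fin 3) (w s)
    have h1 := degreeOf_pow_le (1 : Fin 3) (X 0 : Poly3) (s.1 + mX w).toNat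
    have h2 := degreeOf_pow_le (1 : Fin 3) (X 1 : Poly3) (s.2 + mY w).toNat
    rw [degreeOf_X, if_neg (by decide)] at h1
    rw [degreeOf_X, if_pos rfl] at h2
    have := le_maxY hs
    have := neg_le_mY hs
    omega

lemma IsHadamard.isNotUnivariate {w : WeightedModel} (h : IsHadamard w) : IsNotUnivariate w := by
  obtain ⟨-, hX, hY⟩ := h
  have h1 := degreeOf_zero_kernelPoly_le w
  have h2 := degreeOf_one_kernelPoly_le w
  constructor
  · rcases Nat.eq_zero_or_pos (mX w) with h | h
    · obtain ⟨s, hs, h3⟩ := exists_maxX (w := w) (by omega)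
      exact ⟨s, hs, by omega⟩
    · obtain ⟨s, hs, h3⟩ := exists_mX h
      exact ⟨s, hs, by omega⟩
  · rcases Nat.eq_zero_or_pos (mY w) with h | h
    · obtain ⟨s, hs, h3⟩ := exists_maxY (w := w) (by omega)
      exact ⟨s, hs, by omega⟩
    · obtain ⟨s, hs, h3⟩ := exists_mY h
      exact ⟨s, hs, by omega⟩

/-- The value of a Laurent polynomial in one variable. -/
def laurentEval (P : ℤ →₀ ℂ) (u : KKˣ) : KK :=
  P.sum fun i c => algebraMap ℂ KK c * ((u ^ i : KKˣ) : KK)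

lemma laurentEval_ne_zero {P : ℤ →₀ ℂ} (hP : P ≠ 0) {p : KKˣ × KKˣ} (hp : Generic p) :
    laurentEval P p.1 ≠ 0 := by
  have hinj : Function.Injective fun i : ℤ => (i, (0 : ℤ)) := fun i j h => congrArg Prod.fst h
  have h : stepEval (P.mapDomain fun i => (i, 0)) p = laurentEval P p.1 := by
    unfold stepEval laurentEval
    rw [Finsupp.sum_mapDomain_index_inj hinj]
    simp
  rw [← h]
  refine stepEval_ne_zero (fun h0 => hP ?_) hp
  exact Finsupp.mapDomain_injective hinj (h0.trans Finsupp.mapDomain_zero.symm)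

lemma stepEval_hadamard {w : WeightedModel} {P Q R : ℤ →₀ ℂ}
    (h : ∀ i j : ℤ, w (i, j) = P i * Q j + if j = 0 then R i else 0) (p : KKˣ × KKˣ) :
    stepEval w p = laurentEval P p.1 * laurentEval Q p.2 + laurentEval R p.1 := by
  classical
  have hw : w = ∑ i ∈ P.support, ∑ j ∈ Q.support, Finsupp.single (i, j) (P i * Q j) +
      ∑ i ∈ R.support, Finsupp.single (i, 0) (R i) := by
    ext ⟨i, j⟩
    simp only [h, Finsupp.add_apply, Finsupp.finsetSum_apply, Finsupp.single_apply,
      Prod.mk.injEq]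
    congr 1
    · rw [Finset.sum_eq_single i, Finset.sum_eq_single j]
      · simp
      · intro j' _ hj
        simp [hj]
      · intro hj
        simp [Finsupp.notMem_support_iff.1 hj]
      · intro i' _ hi
        simp [hi]
      · intro hi
        simp [Finsupp.notMem_support_iff.1 hi]
    · rw [Finset.sum_eq_single i]
      · simp [eq_comm]
      · intro i' _ hi
        simp [hi]
      · intro hi
        simp [Finsupp.notMem_support_iff.1 hi]
  rw [hw, stepEval_add, stepEval_sum, stepEval_sum]
  simp only [stepEval_sum, stepEval_single]
  congr 1
  · rw [laurentEval, laurentEval, Finsupp.sum, Finsupp.sum, Finset.sum_mul_sum]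
    refine Finset.sum_congr rfl fun i _ => Finset.sum_congr rfl fun j _ => ?_
    rw [map_mul]
    ring
  · rw [laurentEval, Finsupp.sum]
    exact Finset.sum_congr rfl fun i _ => by simp

/-- Since P(x) ≠ 0, a second point y' of the vertical fibre satisfies Q(y') = Q(y). Then S(·,y') =
S(·,y), so replacing y by y' preserves S also at another abscissa x', which closes the square. -/
lemma IsHadamard.hasInducedSquare {w : WeightedModel} (h : IsHadamard w) :
    HasInducedSquare (orbitGraph w) := by
  have hnu := h.isNotUnivariate
  obtain ⟨⟨P, Q, R, hw⟩, hX, hY⟩ := h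
  have hP : P ≠ 0 := by
    rintro rfl
    obtain ⟨⟨i, j⟩, hs, hj⟩ := hnu.2
    rw [Finsupp.mem_support_iff, hw, if_neg hj] at hs
    simp at hs
  obtain ⟨T, hT, hTv⟩ := generic_xK_yK.exists_fibre hnu.2
  obtain ⟨T', hT', hTu⟩ := generic_xK_yK.exists_fibre' hnu.1
  obtain ⟨y', hy', hyy'⟩ := Finset.exists_mem_ne (s := T)
    (by rw [hT]; exact hY.trans_le (degreeOf_one_kernelPoly_le w)) yK
  obtain ⟨x', hx', hxx'⟩ := Finset.exists_mem_ne (s := T')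
    (by rw [hT']; exact hX.trans_le (degreeOf_zero_kernelPoly_le w)) xK
  have e1 := hTv y' hy'
  have e2 := hTu x' hx'
  have hQ : laurentEval Q y' = laurentEval Q yK := by
    rw [stepEval_hadamard hw, stepEval_hadamard hw] at e1
    exact mul_left_cancel₀ (laurentEval_ne_zero hP generic_xK_yK) (add_right_cancel e1)
  have e3 : stepEval w (x', y') = stepEval w (x', yK) := by
    rw [stepEval_hadamard hw, stepEval_hadamard hw]
    simp only [hQ]
  have m1 := xK_yK_mem_orbit w
  have m2 : (xK, y') ∈ Orbit w := mem_orbit_of_fst_eq m1 rfl e1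
  have m4 : (x', yK) ∈ Orbit w := mem_orbit_of_snd_eq m1 rfl e2
  have m3 : (x', y') ∈ Orbit w := mem_orbit_of_fst_eq m4 rfl e3
  refine ⟨⟨_, m1⟩, ⟨_, m2⟩, ⟨_, m3⟩, ⟨_, m4⟩, ?_⟩
  simp [orbitGraph_adj, hxx', hyy', hxx'.symm, hyy'.symm]

/-! ### Fans -/

lemma fan_apply_natCast {p : ℕ} (z : ℕ → ℂ) {a b : ℕ} (h : a + b ≤ p) :
    fan p z ((a : ℤ), (b : ℤ)) = z (a + b) := by
  classical
  simp only [fan, Finsupp.add_apply, Finsupp.finsetSum_apply, Finsupp.single_apply, Prod.mk.injEq]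
  rw [if_neg (by omega), zero_add, Finset.sum_eq_single (a + b), Finset.sum_eq_single a]
  · exact if_pos ⟨rfl, by push_cast; ring⟩
  · exact fun j _ hj => if_neg (by omega)
  · intro hn
    rw [Finset.mem_range] at hn
    omega
  · exact fun i _ hi => Finset.sum_eq_zero fun j _ => if_neg (by omega)
  · intro hn
    rw [Finset.mem_range] at hn
    omega

lemma fan_apply_neg_one (p : ℕ) (z : ℕ → ℂ) : fan p z (-1, -1) = 1 := by
  classical
  simp only [fan, Finsupp.add_apply, Finsupp.finsetSum_apply, Finsupp.single_apply, Prod.mk.injEq]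
  rw [if_pos (by simp), Finset.sum_eq_zero, add_zero]
  exact fun i _ => Finset.sum_eq_zero fun j _ => if_neg (by omega)

/-- Each homogeneous part of the fan is a geometric sum, and (u-v)/(uv) = 1/v - 1/u. -/
lemma sub_mul_stepEval_fan (p : ℕ) (z : ℕ → ℂ) :
    ∃ g : KKˣ → KK, ∀ u v : KKˣ, ((u : KK) - v) * stepEval (fan p z) (u, v) = g u - g v := by
  refine ⟨fun u => ∑ i ∈ Finset.range (p + 1), algebraMap ℂ KK (z i) * (u : KK) ^ (i + 1) -
    (u : KK)⁻¹, fun u v => ?_⟩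
  have h : ∀ i, ((u : KK) - v) * ∑ j ∈ Finset.range (i + 1),
      stepEval (Finsupp.single ((j : ℤ), (i : ℤ) - (j : ℤ)) (z i)) (u, v) =
        algebraMap ℂ KK (z i) * (u : KK) ^ (i + 1) - algebraMap ℂ KK (z i) * (v : KK) ^ (i + 1) := by
    intro i
    rw [← mul_sub, ← geom_sum₂_mul (u : KK) (v : KK) (i + 1), Finset.sum_mul, Finset.mul_sum,
      Finset.mul_sum]
    refine Finset.sum_congr rfl fun j hj => ?_
    rw [Finset.mem_range] at hj
    rw [stepEval_single, show (i : ℤ) - j = ((i + 1 - 1 - j : ℕ) : ℤ) by omega]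
    simp only [zpow_natCast, Units.val_pow_eq_pow_val]
    ring
  rw [fan, stepEval_add, stepEval_sum, mul_add, Finset.mul_sum]
  simp only [stepEval_sum, h, Finset.sum_sub_distrib]
  rw [stepEval_single]
  have hu := u.ne_zero
  have hv := v.ne_zero
  simp only [map_one, zpow_neg, zpow_one, Units.val_inv_eq_inv_val]
  field_simp
  ring

lemma not_hasGaloisDecoupling_fan {p : ℕ} {z : ℕ → ℂ} (hp : 2 ≤ p) (hz : z p ≠ 0) :
    ¬ HasGaloisDecoupling (fan p z) (fX * fY) := by
  classical
  have hY : ((0 : ℤ), (p : ℤ)) ∈ (fan p z).support := by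
    rw [Finsupp.mem_support_iff]
    have := fan_apply_natCast (p := p) z (a := 0) (b := p) (by omega)
    rw [zero_add] at this
    exact this.trans_ne hz
  have hX : ((p : ℤ), (0 : ℤ)) ∈ (fan p z).support := by
    rw [Finsupp.mem_support_iff]
    exact (fan_apply_natCast (p := p) z (a := p) (b := 0) (by omega)).trans_ne hz
  have hneg : ((-1 : ℤ), (-1 : ℤ)) ∈ (fan p z).support := by
    rw [Finsupp.mem_support_iff, fan_apply_neg_one]
    exact one_ne_zero
  have hnu : IsNotUnivariate (fan p z) :=
    ⟨⟨_, hX, by simp only; omega⟩, ⟨_, hY, by simp only; omega⟩⟩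
  obtain ⟨T, hT, hTv⟩ := generic_xK_yK.exists_fibre hnu.2
  have h1 := neg_le_mY hneg
  have h2 := le_maxY hY
  simp only at h1 h2
  -- Here m_y ≥ 1 and the largest upward move is at least p ≥ 2, so the fibre has at least three
  -- points, two of them different from y.
  have hcard : 1 < (T.erase yK).card := by
    have := Finset.pred_card_le_card_erase (s := T) (a := yK)
    omega
  obtain ⟨a, ha, b, hb, hab⟩ := Finset.one_lt_card.1 hcard
  rw [Finset.mem_erase] at ha hb
  obtain ⟨g, hg⟩ := sub_mul_stepEval_fan p z
  set σ := stepEval (fan p z) (xK, yK) with hσ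
  -- Subtracting (x-y)σ = g(x) - g(y) from (x-c)σ = g(x) - g(c) gives (y-c)σ = g(y) - g(c), which is
  -- (y-c)S(y,c). Hence {x,y} × {a,b} is a square in the orbit.
  have hval : ∀ c ∈ T, c ≠ yK → stepEval (fan p z) (yK, c) = σ := by
    intro c hc hcy
    have e1 := hg xK yK
    have e2 := hg xK c
    have e3 := hg yK c
    rw [hTv c hc] at e2
    have hne : (yK : KK) - c ≠ 0 := sub_ne_zero.2 fun h => hcy (Units.ext h).symm
    refine mul_left_cancel₀ hne ?_
    linear_combination e3 - e2 + e1
  have ma : (xK, a) ∈ Orbit (fan p z) := mem_orbit_of_fst_eq (xK_yK_mem_orbit _) rfl (hTv a ha.2)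
  have mb : (xK, b) ∈ Orbit (fan p z) := mem_orbit_of_fst_eq (xK_yK_mem_orbit _) rfl (hTv b hb.2)
  have ma' : (yK, a) ∈ Orbit (fan p z) :=
    mem_orbit_of_snd_eq ma rfl ((hval a ha.2 ha.1).trans (hTv a ha.2).symm)
  have mb' : (yK, b) ∈ Orbit (fan p z) :=
    mem_orbit_of_snd_eq mb rfl ((hval b hb.2 hb.1).trans (hTv b hb.2).symm)
  have hxy : xK ≠ yK := by
    intro h
    have := AlgebraicIndependent.injective generic_xK_yK (a₁ := 0) (a₂ := 1)
      (congrArg Units.val h)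
    exact absurd this (by decide)
  exact not_hasGaloisDecoupling_of_square hnu hxy hab ma mb mb' ma'

/-! ### Bézout determinants of pairs of cubics -/

section Bezout

variable {R : Type*} [CommRing R]

/-- The value at `u` of the cubic polynomial with coefficients `f 0, …, f 3`. -/
def cubicEval (f : Fin 4 → R) (u : R) : R := f 0 + f 1 * u + f 2 * u ^ 2 + f 3 * u ^ 3

/-- The determinant of a symmetric `3 × 3` matrix. -/
def symDet (e₀₀ e₀₁ e₀₂ e₁₁ e₁₂ e₂₂ : R) : R :=
  e₀₀ * (e₁₁ * e₂₂ - e₁₂ * e₁₂) + e₀₁ * (e₁₂ * e₀₂ - e₀₁ * e₂₂) + e₀₂ * (e₀₁ * e₁₂ - e₁₁ * e₀₂)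

/-- The determinant of the Bézout matrix of two cubics. -/
def bezDet (f g : Fin 4 → R) : R :=
  symDet (f 1 * g 0 - f 0 * g 1) (f 2 * g 0 - f 0 * g 2) (f 3 * g 0 - f 0 * g 3)
    (f 3 * g 0 - f 0 * g 3 + (f 2 * g 1 - f 1 * g 2)) (f 3 * g 1 - f 1 * g 3)
    (f 3 * g 2 - f 2 * g 3)

/-- For three cubics `A, B, C` in `U`, the condition on `s, t` that the quadratic polynomial
`A V ^ 2 + B V + C` has the roots `s` and `t` for some `U`. -/
def pairDet (A B C : Fin 4 → R) (s t : R) : R :=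
  bezDet (fun k => s * t * A k - C k) (fun k => (s + t) * A k + B k)

/-- The determinant of the matrix `E (s i) (t j)`. -/
def gridDet (E : R → R → R) (s₁ s₂ s₃ t₁ t₂ t₃ : R) : R :=
  E s₁ t₁ * (E s₂ t₂ * E s₃ t₃ - E s₂ t₃ * E s₃ t₂) +
    E s₁ t₂ * (E s₂ t₃ * E s₃ t₁ - E s₂ t₁ * E s₃ t₃) +
    E s₁ t₃ * (E s₂ t₁ * E s₃ t₂ - E s₂ t₂ * E s₃ t₁)

lemma map_gridDet_pairDet {R' : Type*} [CommRing R'] (φ : R →+* R') (A B C : Fin 4 → R) :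
    φ (gridDet (pairDet A B C) 1 3 (-3) 0 2 1) =
      gridDet (pairDet (φ ∘ A) (φ ∘ B) (φ ∘ C)) 1 3 (-3) 0 2 1 := by
  simp only [gridDet, pairDet, bezDet, symDet, map_add, map_sub, map_mul, Function.comp_apply,
    map_one, map_neg, map_zero, map_ofNat]

lemma pairDet_comm (A B C : Fin 4 → R) (s t : R) : pairDet A B C s t = pairDet A B C t s := by
  rw [pairDet, pairDet, mul_comm s t, add_comm s t]

lemma symDet_add_mul (m n : Fin 6 → R) :
    ∃ c : Fin 4 → R, ∀ s, symDet (m 0 + s * n 0) (m 1 + s * n 1) (m 2 + s * n 2) (m 3 + s * n 3)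
      (m 4 + s * n 4) (m 5 + s * n 5) = cubicEval c s := by
  let d (m n : Fin 6 → R) : R := n 0 * m 3 * m 5 + m 0 * n 3 * m 5 + m 0 * m 3 * n 5 -
    n 0 * m 4 ^ 2 - 2 * m 0 * m 4 * n 4 - 2 * m 1 * n 1 * m 5 - m 1 ^ 2 * n 5 +
    2 * (n 1 * m 2 * m 4 + m 1 * n 2 * m 4 + m 1 * m 2 * n 4) - n 3 * m 2 ^ 2 - 2 * m 3 * m 2 * n 2
  refine ⟨![symDet (m 0) (m 1) (m 2) (m 3) (m 4) (m 5), d m n, d n m,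
    symDet (n 0) (n 1) (n 2) (n 3) (n 4) (n 5)], fun s => ?_⟩
  simp only [cubicEval, symDet, Matrix.cons_val, d]
  ring

/-- The entries are sums of 2 × 2 minors of the pair stA - C, (s+t)A + B. The minors of A with
itself vanish, so no s² term appears: each entry is affine in s, and the 3 × 3 determinant is cubic.
-/
lemma exists_pairDet_eq_cubicEval (A B C : Fin 4 → R) (t : R) :
    ∃ c : Fin 4 → R, ∀ s, pairDet A B C s t = cubicEval c s := by
  let d (f g : Fin 4 → R) (i j : Fin 4) : R := f i * g j - f j * g i
  let m (i j : Fin 4) : R := - t * d C A i j - d C B i j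
  let n (i j : Fin 4) : R := t * d A B i j - d C A i j
  obtain ⟨c, hc⟩ := symDet_add_mul
    ![m 1 0, m 2 0, m 3 0, m 3 0 + m 2 1, m 3 1, m 3 2]
    ![n 1 0, n 2 0, n 3 0, n 3 0 + n 2 1, n 3 1, n 3 2]
  refine ⟨c, fun s => ?_⟩
  rw [← hc, pairDet, bezDet]
  simp only [Matrix.cons_val, m, n, d]
  congr 1 <;> ring

end Bezout

section Field

variable {K : Type*} [Field K]

/-- The Bézout matrix lists the coefficients of (f(x)g(z) - f(z)g(x))/(x-z), so it kills (1, u, u²)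
at a common root u. -/
lemma bezDet_eq_zero {f g : Fin 4 → K} {u : K} (hf : cubicEval f u = 0) (hg : cubicEval g u = 0) :
    bezDet f g = 0 := by
  let d (i j : Fin 4) : K := f i * g j - f j * g i
  let M : Matrix (Fin 3) (Fin 3) K :=
    !![d 1 0, d 2 0, d 3 0; d 2 0, d 3 0 + d 2 1, d 3 1; d 3 0, d 3 1, d 3 2]
  have hdet : M.det = 0 := by
    refine Matrix.exists_mulVec_eq_zero_iff.1 ⟨![1, u, u ^ 2], fun h => ?_, ?_⟩
    · exact one_ne_zero (congrFun h 0)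
    · unfold cubicEval at hf hg
      ext i
      fin_cases i
      · simp [M, Matrix.mulVec, dotProduct, Fin.sum_univ_three, d]
        linear_combination (f 1 + f 2 * u + f 3 * u ^ 2) * hg - (g 1 + g 2 * u + g 3 * u ^ 2) * hf
      · simp [M, Matrix.mulVec, dotProduct, Fin.sum_univ_three, d]
        linear_combination (f 2 + f 3 * u) * hg - (g 2 + g 3 * u) * hf
      · simp [M, Matrix.mulVec, dotProduct, Fin.sum_univ_three, d]
        linear_combination f 3 * hg - g 3 * hf
  rw [← hdet, Matrix.det_fin_three]
  simp only [bezDet, symDet, M, d, Matrix.of_apply, Matrix.cons_val]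
  ring

/-- Vieta's relations, in a form without division by A(u), make u a common root of the two cubics.
-/
lemma pairDet_eq_zero {A B C : Fin 4 → K} {u a b : K} (hab : a ≠ b)
    (ha : cubicEval A u * a ^ 2 + cubicEval B u * a + cubicEval C u = 0)
    (hb : cubicEval A u * b ^ 2 + cubicEval B u * b + cubicEval C u = 0) :
    pairDet A B C a b = 0 := by
  have h : cubicEval A u * (a + b) + cubicEval B u = 0 := by
    refine mul_left_cancel₀ (sub_ne_zero.2 hab) ?_
    linear_combination ha - hb
  unfold cubicEval at *
  refine bezDet_eq_zero (u := u) ?_ ?_ <;> unfold cubicEval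
  · linear_combination a * h - ha
  · linear_combination h

lemma cubicEval_interpolation (c : Fin 4 → K) {a : Fin 3 → K} (ha : Function.Injective a) (s : K) :
    cubicEval c s = c 3 * ((s - a 0) * (s - a 1) * (s - a 2)) +
      (cubicEval c (a 0) * ((s - a 1) * (s - a 2) / ((a 0 - a 1) * (a 0 - a 2))) +
       cubicEval c (a 1) * ((s - a 0) * (s - a 2) / ((a 1 - a 0) * (a 1 - a 2))) +
       cubicEval c (a 2) * ((s - a 0) * (s - a 1) / ((a 2 - a 0) * (a 2 - a 1)))) := by
  have h01 : a 0 - a 1 ≠ 0 := sub_ne_zero.2 (ha.ne (by decide))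
  have h02 : a 0 - a 2 ≠ 0 := sub_ne_zero.2 (ha.ne (by decide))
  have h12 : a 1 - a 2 ≠ 0 := sub_ne_zero.2 (ha.ne (by decide))
  rw [← neg_sub (a 0) (a 1), ← neg_sub (a 0) (a 2), ← neg_sub (a 1) (a 2)]
  unfold cubicEval
  field_simp
  ring

lemma gridDet_eq_zero_of_rank_le_two {E : K → K → K} {f g h k : K → K}
    (hE : ∀ s t, E s t = f t * g s + h s * k t) (s₁ s₂ s₃ t₁ t₂ t₃ : K) :
    gridDet E s₁ s₂ s₃ t₁ t₂ t₃ = 0 := by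
  simp only [gridDet, hE]
  ring

/-- A symmetric polynomial of bidegree `(3, 3)` that vanishes on a grid of size `3 × 3` has
rank at most `2`. -/
lemma gridDet_eq_zero {E : K → K → K} (hsymm : ∀ s t, E s t = E t s)
    (hcubic : ∀ t, ∃ c : Fin 4 → K, ∀ s, E s t = cubicEval c s) {a b : Fin 3 → K}
    (ha : Function.Injective a) (hb : Function.Injective b) (hE : ∀ i j, E (a i) (b j) = 0)
    (s₁ s₂ s₃ t₁ t₂ t₃ : K) : gridDet E s₁ s₂ s₃ t₁ t₂ t₃ = 0 := by
  choose c hc using hcubic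
  -- By symmetry E(a i, t) is cubic in t, and it vanishes at the three b's.
  have hi : ∀ i t, E (a i) t = c (a i) 3 * ((t - b 0) * (t - b 1) * (t - b 2)) := by
    intro i t
    rw [hsymm, hc, cubicEval_interpolation _ hb]
    simp only [← hc, hsymm _ (a i), hE]
    ring
  obtain ⟨κ, hκ⟩ : ∃ κ : K → K, ∀ s t, E s t = c t 3 * ((s - a 0) * (s - a 1) * (s - a 2)) +
      κ s * ((t - b 0) * (t - b 1) * (t - b 2)) := by
    refine ⟨fun s => c (a 0) 3 * ((s - a 1) * (s - a 2) / ((a 0 - a 1) * (a 0 - a 2))) +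
      c (a 1) 3 * ((s - a 0) * (s - a 2) / ((a 1 - a 0) * (a 1 - a 2))) +
      c (a 2) 3 * ((s - a 0) * (s - a 1) / ((a 2 - a 0) * (a 2 - a 1))), fun s t => ?_⟩
    rw [hc, cubicEval_interpolation _ ha]
    simp only [← hc, hi]
    ring
  exact gridDet_eq_zero_of_rank_le_two (f := fun t => c t 3)
    (g := fun s => (s - a 0) * (s - a 1) * (s - a 2))
    (k := fun t => (t - b 0) * (t - b 1) * (t - b 2)) hκ _ _ _ _ _ _

end Field

/-! ### The computation over the models with small coefficients -/

section Computation

-- The determinant is evaluated in ℕ by kernel arithmetic: a residue of -1 replaces subtraction, and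
-- reduction happens only once, at the end.
local infixl:65 " +ₙ " => Nat.add
local infixl:70 " *ₙ " => Nat.mul

/-- The determinant `symDet`, where `m` stands for `-1`. -/
def natSymDet (m e₀₀ e₀₁ e₀₂ e₁₁ e₁₂ e₂₂ : ℕ) : ℕ :=
  e₀₀ *ₙ (e₁₁ *ₙ e₂₂ +ₙ m *ₙ e₁₂ *ₙ e₁₂) +ₙ e₀₁ *ₙ (e₁₂ *ₙ e₀₂ +ₙ m *ₙ e₀₁ *ₙ e₂₂) +ₙ
    e₀₂ *ₙ (e₀₁ *ₙ e₁₂ +ₙ m *ₙ e₁₁ *ₙ e₀₂)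

/-- The determinant `bezDet`, where `m` stands for `-1` and `h` for `-g`. -/
def natBezDet (m f₀ f₁ f₂ f₃ g₀ g₁ g₂ h₁ h₂ h₃ : ℕ) : ℕ :=
  natSymDet m (f₁ *ₙ g₀ +ₙ f₀ *ₙ h₁) (f₂ *ₙ g₀ +ₙ f₀ *ₙ h₂) (f₃ *ₙ g₀ +ₙ f₀ *ₙ h₃)
    (f₃ *ₙ g₀ +ₙ f₀ *ₙ h₃ +ₙ (f₂ *ₙ g₁ +ₙ f₁ *ₙ h₂)) (f₃ *ₙ g₁ +ₙ f₁ *ₙ h₃) (f₃ *ₙ g₂ +ₙ f₂ *ₙ h₃)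

/-- The determinant `pairDet`, where `m` stands for `-1`. -/
def natPairDet (m a₀ a₁ a₂ a₃ b₀ b₁ b₂ b₃ c₀ c₁ c₂ c₃ s t : ℕ) : ℕ :=
  natBezDet m (s *ₙ t *ₙ a₀ +ₙ m *ₙ c₀) (s *ₙ t *ₙ a₁ +ₙ m *ₙ c₁) (s *ₙ t *ₙ a₂ +ₙ m *ₙ c₂)
    (s *ₙ t *ₙ a₃ +ₙ m *ₙ c₃) ((s +ₙ t) *ₙ a₀ +ₙ b₀) ((s +ₙ t) *ₙ a₁ +ₙ b₁) ((s +ₙ t) *ₙ a₂ +ₙ b₂)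
    (m *ₙ ((s +ₙ t) *ₙ a₁ +ₙ b₁)) (m *ₙ ((s +ₙ t) *ₙ a₂ +ₙ b₂)) (m *ₙ ((s +ₙ t) *ₙ a₃ +ₙ b₃))

/-- The determinant `gridDet`, where `m` stands for `-1`. -/
def natGridDet (m : ℕ) (E : ℕ → ℕ → ℕ) (s₁ s₂ s₃ t₁ t₂ t₃ : ℕ) : ℕ :=
  E s₁ t₁ *ₙ (E s₂ t₂ *ₙ E s₃ t₃ +ₙ m *ₙ E s₂ t₃ *ₙ E s₃ t₂) +ₙ
    E s₁ t₂ *ₙ (E s₂ t₃ *ₙ E s₃ t₁ +ₙ m *ₙ E s₂ t₁ *ₙ E s₃ t₃) +ₙ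
    E s₁ t₃ *ₙ (E s₂ t₁ *ₙ E s₃ t₂ +ₙ m *ₙ E s₂ t₂ *ₙ E s₃ t₁)

/-- The determinant of a certain `3 × 3` grid vanishes modulo `10 ^ 9 + 7`. -/
def gridVanishes (a₀ a₁ a₂ a₃ b₀ b₁ b₂ b₃ c₀ c₁ c₂ c₃ : ℕ) : Bool :=
  Nat.beq (Nat.mod (natGridDet 1000000006
    (natPairDet 1000000006 a₀ a₁ a₂ a₃ b₀ b₁ b₂ b₃ c₀ c₁ c₂ c₃) 1 3 1000000004 0 2 1) 1000000007) 0

/-- A Boolean as a coefficient. -/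
def bit (b : Bool) : ℕ := cond b 1 0

/-- The conjunction of the two values of a Boolean predicate. -/
def allBool (f : Bool → Bool) : Bool := f false && f true

lemma allBool_apply {f : Bool → Bool} (h : allBool f = true) (b : Bool) : f b = true := by
  rw [allBool, Bool.and_eq_true] at h
  cases b
  exacts [h.1, h.2]

lemma natGridDet_cast {R : Type*} [CommRing R] {m : ℕ} (hm : (m : R) = -1)
    (A B C : Fin 4 → ℕ) (s₁ s₂ s₃ t₁ t₂ t₃ : ℕ) :
    (natGridDet m (natPairDet m (A 0) (A 1) (A 2) (A 3) (B 0) (B 1) (B 2) (B 3)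
      (C 0) (C 1) (C 2) (C 3)) s₁ s₂ s₃ t₁ t₂ t₃ : R) =
        gridDet (pairDet (fun k => (A k : R)) (fun k => (B k : R)) fun k => (C k : R))
          s₁ s₂ s₃ t₁ t₂ t₃ := by
  have hE : ∀ s t : ℕ, (natPairDet m (A 0) (A 1) (A 2) (A 3) (B 0) (B 1) (B 2) (B 3)
      (C 0) (C 1) (C 2) (C 3) s t : R) =
        pairDet (fun k => (A k : R)) (fun k => (B k : R)) (fun k => (C k : R)) s t := by
    intro s t
    simp only [natPairDet, natBezDet, natSymDet, pairDet, bezDet, symDet, Nat.add_eq, Nat.mul_eq,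
      Nat.cast_add, Nat.cast_mul, hm, neg_mul, one_mul, mul_neg, ← sub_eq_add_neg]
  simp only [natGridDet, gridDet, Nat.add_eq, Nat.mul_eq, Nat.cast_add, Nat.cast_mul, hE, hm,
    neg_mul, one_mul, ← sub_eq_add_neg]

/-- The residues 10⁹+6 and 10⁹+4 stand for -1 and -3. Primality of the modulus plays no role. -/
lemma gridVanishes_of_gridDet {n : ℕ} (hn : n = 1000000007) {A B C : Fin 4 → ℕ}
    (h : gridDet (pairDet (fun k => (A k : ZMod n)) (fun k => (B k : ZMod n))
      fun k => (C k : ZMod n)) 1 3 (-3) 0 2 1 = 0) :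
    gridVanishes (A 0) (A 1) (A 2) (A 3) (B 0) (B 1) (B 2) (B 3) (C 0) (C 1) (C 2) (C 3) =
      true := by
  have hn0 : ((1000000007 : ℕ) : ZMod n) = 0 := by rw [← hn, ZMod.natCast_self]
  have hm : ((1000000006 : ℕ) : ZMod n) = -1 := by
    rw [eq_neg_iff_add_eq_zero]
    exact_mod_cast hn0
  have h3 : ((1000000004 : ℕ) : ZMod n) = -3 := by
    rw [eq_neg_iff_add_eq_zero]
    exact_mod_cast hn0
  have := natGridDet_cast hm A B C 1 3 1000000004 0 2 1
  rw [h3] at this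
  simp only [Nat.cast_one, Nat.cast_ofNat, Nat.cast_zero, h] at this
  rw [ZMod.natCast_eq_zero_iff, hn] at this
  rw [gridVanishes]
  exact Nat.beq_eq ▸ Nat.mod_eq_zero_of_dvd this

/-- The bits a, b, c are the rows Y, 1, 1/Y, shifted by X; adding 10⁹ to the coefficient of U in b
subtracts σ = 7. The first clause discards sets of too small degree, the second contains the two
factored exceptions, with b₁ free. -/
lemma computation_central :
    (allBool fun a₀ => allBool fun a₁ => allBool fun a₂ => allBool fun a₃ =>
      allBool fun b₀ => allBool fun b₁ => allBool fun b₂ => allBool fun b₃ =>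
      allBool fun c₀ => allBool fun c₁ => allBool fun c₂ => allBool fun c₃ =>
      !((a₀ || a₁ || a₂ || a₃) && (c₀ || c₁ || c₂ || c₃) && (a₀ || b₀ || c₀) && (a₃ || b₃ || c₃)) ||
      (b₀ && !b₂ && b₃ && ((!a₀ && !a₁ && !a₂ && a₃ && c₀ && !c₁ && !c₂ && !c₃) ||
        (a₀ && !a₁ && !a₂ && !a₃ && !c₀ && !c₁ && !c₂ && c₃))) ||
      !gridVanishes (bit a₀) (bit a₁) (bit a₂) (bit a₃)
        (bit b₀) (bit b₁ +ₙ 1000000000) (bit b₂) (bit b₃)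
        (bit c₀) (bit c₁) (bit c₂) (bit c₃)) = true := by
  decide +kernel

/-- Here the rows are Y², Y, 1, so σ is subtracted in c. No exception survives. -/
lemma computation_upper :
    (allBool fun a₀ => allBool fun a₁ => allBool fun a₂ => allBool fun a₃ =>
      allBool fun b₀ => allBool fun b₁ => allBool fun b₂ => allBool fun b₃ =>
      allBool fun c₀ => allBool fun c₁ => allBool fun c₂ => allBool fun c₃ =>
      !((a₀ || a₁ || a₂ || a₃) && (a₀ || b₀ || c₀) && (a₃ || b₃ || c₃)) ||
      !gridVanishes (bit a₀) (bit a₁) (bit a₂) (bit a₃) (bit b₀) (bit b₁) (bit b₂) (bit b₃)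
        (bit c₀) (bit c₁ +ₙ 1000000000) (bit c₂) (bit c₃)) = true := by
  decide +kernel

end Computation

/-! ### Orbits of type `O18` -/

lemma O18_adj_of_fst_eq (e : Fin 3 × Fin 3) : O18.Adj (e, false) (e, true) := by
  simp [O18]

lemma O18_adj_false {i j j' : Fin 3} (h : j ≠ j') : O18.Adj ((i, j), false) ((i, j'), false) := by
  simp [O18, h]

lemma O18_adj_true {i i' j : Fin 3} (h : i ≠ i') : O18.Adj ((i, j), true) ((i', j), true) := by
  simp [O18, h]

lemma O18_not_adj {i j i' j' : Fin 3} (h : (i, j) ≠ (i', j')) :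
    ¬ O18.Adj ((i, j), false) ((i', j'), true) := by
  have h' : ¬ (i = i' ∧ j = j') := by simpa using h
  simp only [O18, SimpleGraph.fromRel_adj]
  grind

lemma O18_not_adj_false {i j i' j' : Fin 3} (h : i ≠ i') :
    ¬ O18.Adj ((i, j), false) ((i', j'), false) := by
  simp [O18, h, h.symm]

lemma O18_not_adj_true {i j i' j' : Fin 3} (h : j ≠ j') :
    ¬ O18.Adj ((i, j), true) ((i', j'), true) := by
  simp [O18, h, h.symm]

/-- The points of a realization of `O18` by pairs, two of which are adjacent when they have a
coordinate in common: either the cliques of size `2` share the first coordinate and those of size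
`3` the second one, or conversely. -/
lemma O18_realization {α β : Type*} {P : (Fin 3 × Fin 3) × Bool → α × β}
    (hadj : ∀ x y, x ≠ y → (O18.Adj x y ↔ (P x).1 = (P y).1 ∨ (P x).2 = (P y).2))
    (h0 : (P ((0, 0), false)).1 = (P ((0, 0), true)).1) :
    (∀ e, (P (e, false)).1 = (P (e, true)).1) ∧
      (∀ i j j', (P ((i, j), false)).2 = (P ((i, j'), false)).2) ∧
      ∀ i i' j, (P ((i, j), true)).2 = (P ((i', j), true)).2 := by
  have hne : ∀ {x y}, O18.Adj x y → x ≠ y := fun h => h.ne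
  -- Along an induced path y, x, z the two edges use different coordinates. This propagates the
  -- choice made at one edge of K₃,₃ to all the others.
  have step1 : ∀ {x y z}, O18.Adj x y → O18.Adj x z → ¬ O18.Adj y z → y ≠ z →
      (P x).1 = (P y).1 → (P x).2 = (P z).2 := by
    intro x y z hxy hxz hyz hne' h
    refine ((hadj x z hxz.ne).1 hxz).resolve_left fun h' => hyz ?_
    exact (hadj y z hne').2 (Or.inl (h.symm.trans h'))
  have step2 : ∀ {x y z}, O18.Adj x y → O18.Adj x z → ¬ O18.Adj y z → y ≠ z →
      (P x).2 = (P y).2 → (P x).1 = (P z).1 := by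
    intro x y z hxy hxz hyz hne' h
    refine ((hadj x z hxz.ne).1 hxz).resolve_right fun h' => hyz ?_
    exact (hadj y z hne').2 (Or.inr (h.symm.trans h'))
  have hF : ∀ {i j j'}, (P ((i, j), false)).1 = (P ((i, j), true)).1 →
      (P ((i, j), false)).2 = (P ((i, j'), false)).2 := by
    intro i j j' h
    by_cases hj : j = j'
    · rw [hj]
    · exact step1 (O18_adj_of_fst_eq _) (O18_adj_false hj)
        (fun h => O18_not_adj (by simpa using Ne.symm hj) h.symm) (by simp) h
  have hT : ∀ {i i' j}, (P ((i, j), false)).1 = (P ((i, j), true)).1 →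
      (P ((i, j), true)).2 = (P ((i', j), true)).2 := by
    intro i i' j h
    by_cases hi : i = i'
    · rw [hi]
    · exact step1 (O18_adj_of_fst_eq _).symm (O18_adj_true hi)
        (O18_not_adj (by simpa using hi)) (by simp) h.symm
  have hM1 : ∀ {i j j'}, (P ((i, j), false)).1 = (P ((i, j), true)).1 →
      (P ((i, j'), false)).1 = (P ((i, j'), true)).1 := by
    intro i j j' h
    by_cases hj : j = j'
    · rw [← hj, h]
    · exact step2 (O18_adj_false (Ne.symm hj)) (O18_adj_of_fst_eq _)
        (O18_not_adj (by simpa using hj)) (by simp) (hF h).symm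
  have hM2 : ∀ {i i' j}, (P ((i, j), false)).1 = (P ((i, j), true)).1 →
      (P ((i', j), false)).1 = (P ((i', j), true)).1 := by
    intro i i' j h
    by_cases hi : i = i'
    · rw [← hi, h]
    · exact (step2 (O18_adj_true (Ne.symm hi)) (O18_adj_of_fst_eq _).symm
        (fun h => O18_not_adj (by simpa using Ne.symm hi) h.symm) (by simp) (hT h).symm).symm
  have hM : ∀ e, (P (e, false)).1 = (P (e, true)).1 := fun e => hM2 (hM1 h0)
  exact ⟨hM, fun i j j' => hF (hM _), fun i i' j => hT (hM _)⟩

/-- Parametrization of a set of pairs of type `O18`: `U i j` belongs to the edge `(i, j)`, and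
`a i`, `b j` belong to its endpoints. -/
structure IsGrid {α β : Type*} (O : Set (α × β)) (U : Fin 3 → Fin 3 → α) (a b : Fin 3 → β) :
    Prop where
  left_mem : ∀ i j, (U i j, a i) ∈ O
  right_mem : ∀ i j, (U i j, b j) ∈ O
  left_injective : Function.Injective a
  right_injective : Function.Injective b
  left_ne_right : ∀ i j, a i ≠ b j
  eq_or_eq : ∀ i j v, (U i j, v) ∈ O → v = a i ∨ v = b j

lemma exists_isGrid_of_realization {α β : Type*} {P : (Fin 3 × Fin 3) × Bool → α × β}
    (hinj : Function.Injective P)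
    (hadj : ∀ x y, x ≠ y → (O18.Adj x y ↔ (P x).1 = (P y).1 ∨ (P x).2 = (P y).2))
    (h0 : (P ((0, 0), false)).1 = (P ((0, 0), true)).1) :
    ∃ U a b, IsGrid (Set.range P) U a b := by
  obtain ⟨hM, hF, hT⟩ := O18_realization hadj h0
  have hl : ∀ i j, P ((i, j), false) = ((P ((i, j), false)).1, (P ((i, 0), false)).2) :=
    fun i j => Prod.ext rfl (hF i j 0)
  have hr : ∀ i j, P ((i, j), true) = ((P ((i, j), false)).1, (P ((0, j), true)).2) :=
    fun i j => Prod.ext (hM _).symm (hT i 0 j)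
  refine ⟨fun i j => (P ((i, j), false)).1, fun i => (P ((i, 0), false)).2,
    fun j => (P ((0, j), true)).2, ⟨fun i j => ⟨_, hl i j⟩, fun i j => ⟨_, hr i j⟩, ?_, ?_, ?_, ?_⟩⟩
  · intro i i' h
    by_contra hne
    exact O18_not_adj_false hne ((hadj _ _ (by simpa using hne)).2 (Or.inr h))
  · intro j j' h
    by_contra hne
    exact O18_not_adj_true hne ((hadj _ _ (by simpa using hne)).2 (Or.inr h))
  · intro i j h
    have h : P ((i, j), false) = P ((i, j), true) := by
      rw [hl, hr]
      exact Prod.ext rfl h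
    simpa using hinj h
  · rintro i j v ⟨⟨⟨i', j'⟩, s⟩, hz⟩
    by_cases he : (i, j) = (i', j')
    · cases he
      cases s
      · rw [hl] at hz
        exact Or.inl (congrArg Prod.snd hz).symm
      · rw [hr] at hz
        exact Or.inr (congrArg Prod.snd hz).symm
    -- A further point over U i j would be adjacent to both points of the edge (i,j), but a point of
    -- another edge is never adjacent to the one of opposite side.
    · exfalso
      have h1 : (P ((i', j'), s)).1 = (P ((i, j), false)).1 := by rw [hz]
      cases s
      · refine O18_not_adj (Ne.symm he) ((hadj _ _ (by simp)).2 (Or.inl ?_))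
        rw [h1, hM]
      · exact O18_not_adj he ((hadj _ _ (by simp)).2 (Or.inl h1.symm))

/-- A graph isomorphism does not record which coordinate the cliques of size 2 share, hence the two
cases. -/
lemma exists_isGrid {w : WeightedModel} (h : HasOrbitType w O18) :
    (∃ U a b, IsGrid (Orbit w) U a b) ∨ ∃ U a b, IsGrid (Prod.swap ⁻¹' Orbit w) U a b := by
  obtain ⟨e⟩ := h
  let P : (Fin 3 × Fin 3) × Bool → KKˣ × KKˣ := fun x => (e.symm x).1
  have hinj : Function.Injective P := Subtype.val_injective.comp e.symm.injective
  have hadj : ∀ x y, x ≠ y → (O18.Adj x y ↔ (P x).1 = (P y).1 ∨ (P x).2 = (P y).2) := by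
    intro x y hxy
    rw [← e.symm.map_adj_iff, orbitGraph_adj]
    exact and_iff_right (e.symm.injective.ne hxy)
  have hrange : Set.range P = Orbit w := by
    rw [show P = Subtype.val ∘ e.symm from rfl, Set.range_comp, e.symm.surjective.range_eq]
    simp
  rcases (hadj _ _ (O18_adj_of_fst_eq (0, 0)).ne).1 (O18_adj_of_fst_eq (0, 0)) with h | h
  · left
    rw [← hrange]
    exact exists_isGrid_of_realization hinj hadj h
  · right
    have : Prod.swap ⁻¹' Orbit w = Set.range (Prod.swap ∘ P) := by
      rw [← hrange, Set.range_comp, Set.image_swap_eq_preimage_swap]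
    rw [this]
    exact exists_isGrid_of_realization (Prod.swap_injective.comp hinj)
      (fun x y hxy => (hadj x y hxy).trans or_comm) h

/-! ### Models with small steps whose orbit has type `O18` -/

lemma Generic.card_fibre_le {w : WeightedModel} (hw : ∃ s ∈ w.support, s.2 ≠ 0)
    {p : KKˣ × KKˣ} (hp : Generic p) {T : Finset KKˣ}
    (hT : ∀ v ∈ T, stepEval w (p.1, v) = stepEval w p) : T.card ≤ mY w + maxY w := by
  classical
  set P := fibrePoly w p.1 (stepEval w p)
  have hP : P ≠ 0 := by
    intro h
    have := hp.eval_derivative_fibrePoly_ne_zero hw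
    rw [show fibrePoly w p.1 (stepEval w p) = 0 from h] at this
    simp at this
  rw [← Finset.card_image_of_injective T (Units.val_injective (α := KK))]
  refine le_trans ?_ (natDegree_fibrePoly_le w p.1 (stepEval w p))
  refine Polynomial.card_le_degree_of_subset_roots (p := P) fun z hz => ?_
  rw [Finset.mem_val, Finset.mem_image] at hz
  obtain ⟨v, hv, rfl⟩ := hz
  rw [Polynomial.mem_roots hP, Polynomial.IsRoot]
  have := eval_fibrePoly w (p.1, v) (stepEval w p)
  rw [hT v hv, sub_self, mul_zero] at this
  exact this

lemma Generic.card_fibre_le' {w : WeightedModel} (hw : ∃ s ∈ w.support, s.1 ≠ 0)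
    {p : KKˣ × KKˣ} (hp : Generic p) {T : Finset KKˣ}
    (hT : ∀ u ∈ T, stepEval w (u, p.2) = stepEval w p) : T.card ≤ mX w + maxX w := by
  rw [← mY_transpose, ← maxY_transpose]
  refine hp.swap.card_fibre_le (exists_support_transpose hw) fun u hu => ?_
  rw [stepEval_transpose, show (p.swap.1, u) = (u, p.2).swap from rfl, stepEval_transpose]
  exact hT u hu

lemma unweighted_apply (𝒮 : Finset (ℤ × ℤ)) (s : ℤ × ℤ) :
    unweighted 𝒮 s = if s ∈ 𝒮 then 1 else 0 := by
  classical
  simp [unweighted, Finsupp.finsetSum_apply, Finsupp.single_apply]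

lemma mem_support_unweighted {𝒮 : Finset (ℤ × ℤ)} {s : ℤ × ℤ} :
    s ∈ (unweighted 𝒮).support ↔ s ∈ 𝒮 := by
  rw [Finsupp.mem_support_iff, unweighted_apply]
  simp

lemma transpose_unweighted (𝒮 : Finset (ℤ × ℤ)) :
    transpose (unweighted 𝒮) = unweighted (𝒮.map (Equiv.prodComm ℤ ℤ).toEmbedding) := by
  ext s
  rw [transpose_apply, unweighted_apply, unweighted_apply]
  have : s ∈ 𝒮.map (Equiv.prodComm ℤ ℤ).toEmbedding ↔ s.swap ∈ 𝒮 := by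
    rw [Finset.mem_map_equiv]
    rfl
  simp only [this]

/-- Whether `X ^ (k - 1) Y ^ j` occurs in the step polynomial. -/
def stepBit (𝒮 : Finset (ℤ × ℤ)) (j : ℤ) (k : Fin 4) : Bool := decide (((k : ℤ) - 1, j) ∈ 𝒮)

lemma mul_rowEval_unweighted {𝒮 : Finset (ℤ × ℤ)}
    (h𝒮 : 𝒮 ⊆ Finset.Icc (-1) 2 ×ˢ Finset.Icc (-1) 2) (j : ℤ) (u : KKˣ) :
    (u : KK) * rowEval (unweighted 𝒮) j u =
      cubicEval (fun k => (bit (stepBit 𝒮 j k) : KK)) u := by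
  have hrow : row (unweighted 𝒮) j =
      ∑ k : Fin 4, Finsupp.single ((k : ℤ) - 1, j) (bit (stepBit 𝒮 j k) : ℂ) := by
    ext ⟨i, j'⟩
    rw [row, Finsupp.filter_apply, unweighted_apply, Finsupp.finsetSum_apply]
    by_cases hj : j' = j
    · subst hj
      by_cases hi : -1 ≤ i ∧ i ≤ 2
      · obtain ⟨h1, h2⟩ := hi
        simp only [Finsupp.single_apply, Prod.mk.injEq, Fin.sum_univ_four]
        interval_cases i <;> simp [stepBit, bit] <;> split_ifs <;> simp_all
      · have hn : (i, j') ∉ 𝒮 := by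
          intro h
          have := h𝒮 h
          rw [Finset.mem_product, Finset.mem_Icc] at this
          exact hi this.1
        rw [if_neg hn, if_pos rfl, Finset.sum_eq_zero]
        intro k _
        rw [Finsupp.single_apply, if_neg]
        rw [Prod.mk.injEq]
        have := k.isLt
        omega
    · rw [if_neg hj, Finset.sum_eq_zero]
      intro k _
      rw [Finsupp.single_apply, if_neg]
      rw [Prod.mk.injEq]
      exact fun h => hj h.2.symm
  rw [rowEval, hrow, stepEval_sum]
  simp only [stepEval_single, Fin.sum_univ_four, cubicEval, one_zpow, Units.val_one, mul_one,
    map_natCast]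
  have hu := u.ne_zero
  simp [zpow_neg, mul_add]
  field_simp

lemma eq_zero_of_eval₂_stepEval {w : WeightedModel} (hw : ∃ s ∈ w.support, s.2 ≠ 0)
    {p : KKˣ × KKˣ} (hp : Generic p) (P : Polynomial ℤ)
    (hP : P.eval₂ (Int.castRingHom KK) (stepEval w p) = 0) : P = 0 := by
  by_contra hP0
  refine hp.transcendental_stepEval hw ⟨P.map (Int.castRingHom _), ?_, ?_⟩
  · rwa [Ne, Polynomial.map_eq_zero_iff (RingHom.injective_int _)]
  · rw [Polynomial.aeval_def, Polynomial.eval₂_map, ← hP]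
    congr 1

/-- The determinant is the value at the transcendental σ of an integer polynomial, which is
therefore zero and stays zero under σ ↦ 7 in `ZMod n`. The vectors d and e say where σ is
subtracted, so that both vertical positions are covered. -/
lemma gridVanishes_of_grid {K : Type*} [Field K] {σ : K}
    (hσ : ∀ P : Polynomial ℤ, P.eval₂ (Int.castRingHom K) σ = 0 → P = 0)
    (α β γ d e : Fin 4 → ℕ) {U : Fin 3 → Fin 3 → K} {a b : Fin 3 → K}
    (ha : Function.Injective a) (hb : Function.Injective b) (hab : ∀ i j, a i ≠ b j)
    (h : ∀ i j v, v = a i ∨ v = b j → cubicEval (fun k => (α k : K)) (U i j) * v ^ 2 +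
      cubicEval (fun k => β k - d k * σ) (U i j) * v +
        cubicEval (fun k => γ k - e k * σ) (U i j) = 0) :
    gridVanishes (α 0) (α 1) (α 2) (α 3) (β 0 + d 0 * 1000000000) (β 1 + d 1 * 1000000000)
      (β 2 + d 2 * 1000000000) (β 3 + d 3 * 1000000000) (γ 0 + e 0 * 1000000000)
      (γ 1 + e 1 * 1000000000) (γ 2 + e 2 * 1000000000) (γ 3 + e 3 * 1000000000) = true := by
  set A : Fin 4 → Polynomial ℤ := fun k => (α k : Polynomial ℤ)
  set B : Fin 4 → Polynomial ℤ := fun k => (β k : Polynomial ℤ) - (d k : Polynomial ℤ) * Polynomial.X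
  set C : Fin 4 → Polynomial ℤ := fun k => (γ k : Polynomial ℤ) - (e k : Polynomial ℤ) * Polynomial.X
  have hK : gridDet (pairDet (fun k => (α k : K)) (fun k => β k - d k * σ)
      fun k => γ k - e k * σ) 1 3 (-3) 0 2 1 = 0 :=
    gridDet_eq_zero (pairDet_comm _ _ _) (exists_pairDet_eq_cubicEval _ _ _) ha hb
      (fun i j => pairDet_eq_zero (hab i j) (h i j _ (Or.inl rfl)) (h i j _ (Or.inr rfl))) _ _ _ _ _ _
  have hpoly : gridDet (pairDet A B C) 1 3 (-3) 0 2 1 = 0 := by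
    apply hσ
    rw [← Polynomial.coe_eval₂RingHom, map_gridDet_pairDet]
    refine Eq.trans ?_ hK
    congr 2 <;> ext k <;> simp [A, B, C]
  obtain ⟨n, hn⟩ : ∃ n : ℕ, n = 1000000007 := ⟨_, rfl⟩
  have hmod := congrArg (Polynomial.eval₂RingHom (Int.castRingHom (ZMod n)) 7) hpoly
  rw [map_gridDet_pairDet, map_zero] at hmod
  have h7 : (1000000000 : ZMod n) = -7 := by
    have hn0 : ((1000000007 : ℕ) : ZMod n) = 0 := by rw [← hn, ZMod.natCast_self]
    rw [eq_neg_iff_add_eq_zero]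
    exact_mod_cast hn0
  have hfin := gridVanishes_of_gridDet hn (A := α) (B := fun k => β k + d k * 1000000000)
    (C := fun k => γ k + e k * 1000000000)
  beta_reduce at hfin
  apply hfin
  refine Eq.trans ?_ hmod
  congr 2 <;> ext k <;> simp [A, B, C, h7, sub_eq_add_neg]

/-- The alternating sum of U i j (a i - b j) over rows 0, 1 and columns 0, j vanishes. With U
explicit it factors through (a 0 - a 1)(b 0 - b j), leaving a 0 + a 1 = b 0 + b j, respectively a 0
* a 1 = b 0 * b j. Taking j = 1, 2 gives b 1 = b 2. -/
lemma false_of_factored_grid {K : Type*} [Field K] {τ : K} {U : Fin 3 → Fin 3 → K}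
    {a b : Fin 3 → K} (hb0 : ∀ i, b i ≠ 0) (ha : Function.Injective a)
    (hb : Function.Injective b) (G : K → K)
    (hG : ∀ i j, U i j * (a i - b j) = G (a i) - G (b j))
    (hU : (∀ i j, τ * U i j = (1 + a i) * (1 + b j)) ∨
      ∀ i j, τ * U i j * (a i * b j) = (1 + a i) * (1 + b j)) : False := by
  have hsum : ∀ j, U 0 0 * (a 0 - b 0) - U 1 0 * (a 1 - b 0) + U 1 j * (a 1 - b j) -
      U 0 j * (a 0 - b j) = 0 := by
    intro j
    rw [hG, hG, hG, hG]
    ring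
  have ha01 : a 0 - a 1 ≠ 0 := sub_ne_zero.2 (ha.ne (by decide))
  have hb0j : ∀ j, j ≠ 0 → b 0 - b j ≠ 0 := fun j hj => sub_ne_zero.2 (hb.ne hj.symm)
  rcases hU with hU | hU
  · have key : ∀ j, j ≠ 0 → a 0 + a 1 = b 0 + b j := by
      intro j hj
      refine sub_eq_zero.1 (mul_left_cancel₀ (mul_ne_zero ha01 (hb0j j hj)) ?_)
      linear_combination τ * hsum j - (a 0 - b 0) * hU 0 0 + (a 1 - b 0) * hU 1 0 -
        (a 1 - b j) * hU 1 j + (a 0 - b j) * hU 0 j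
    have h12 : b 1 = b 2 := by
      linear_combination key 2 (by decide) - key 1 (by decide)
    exact absurd (hb h12) (by decide)
  · have key : ∀ j, j ≠ 0 → a 0 * a 1 = b 0 * b j := by
      intro j hj
      refine sub_eq_zero.1 (mul_left_cancel₀ (mul_ne_zero ha01 (hb0j j hj)) ?_)
      linear_combination -(τ * a 0 * a 1 * b 0 * b j) * hsum j +
        (a 1 * b j * (a 0 - b 0)) * hU 0 0 - (a 0 * b j * (a 1 - b 0)) * hU 1 0 +
        (a 0 * b 0 * (a 1 - b j)) * hU 1 j - (a 1 * b 0 * (a 0 - b j)) * hU 0 j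
    have h12 : b 1 = b 2 := by
      refine mul_left_cancel₀ (hb0 0) ?_
      rw [← key 1 (by decide), key 2 (by decide)]
    exact absurd (hb h12) (by decide)

lemma stepBit_of_mem {𝒮 : Finset (ℤ × ℤ)} {i j : ℤ} {k : Fin 4} (h : (i, j) ∈ 𝒮)
    (hk : (k : ℤ) - 1 = i) : stepBit 𝒮 j k = true := by
  rw [stepBit, decide_eq_true_eq, hk]
  exact h

lemma exists_stepBit {𝒮 : Finset (ℤ × ℤ)} (h𝒮 : 𝒮 ⊆ Finset.Icc (-1) 2 ×ˢ Finset.Icc (-1) 2)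
    {s : ℤ × ℤ} (hs : s ∈ 𝒮) : (stepBit 𝒮 s.2 0 || stepBit 𝒮 s.2 1 || stepBit 𝒮 s.2 2 ||
      stepBit 𝒮 s.2 3) = true := by
  obtain ⟨i, j⟩ := s
  have h := h𝒮 hs
  rw [Finset.mem_product, Finset.mem_Icc, Finset.mem_Icc] at h
  obtain ⟨⟨h1, h2⟩, -⟩ := h
  simp only at h1 h2
  simp only [Bool.or_eq_true]
  interval_cases i
  · exact Or.inl (Or.inl (Or.inl (stepBit_of_mem hs rfl)))
  · exact Or.inl (Or.inl (Or.inr (stepBit_of_mem hs rfl)))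
  · exact Or.inl (Or.inr (stepBit_of_mem hs rfl))
  · exact Or.inr (stepBit_of_mem hs rfl)

/-- A set of generic points of a level set of the step polynomial that is parametrized as `O18`
does not admit a decoupling of `XY`. -/
lemma IsGrid.not_decoupled {𝒮 : Finset (ℤ × ℤ)}
    (h𝒮 : 𝒮 ⊆ Finset.Icc (-1) 2 ×ˢ Finset.Icc (-1) 2) (hnu : IsNotUnivariate (unweighted 𝒮))
    {O : Set (KKˣ × KKˣ)} {σ : KK} (hO : ∀ p ∈ O, Generic p ∧ stepEval (unweighted 𝒮) p = σ)
    (hO' : ∀ p ∈ O, ∀ v, stepEval (unweighted 𝒮) (p.1, v) = σ → (p.1, v) ∈ O)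
    {U : Fin 3 → Fin 3 → KKˣ} {a b : Fin 3 → KKˣ} (h : IsGrid O U a b) {F G : KKˣ → KK}
    (hFG : ∀ p ∈ O, (p.1 : KK) * p.2 = F p.1 + G p.2) : False := by
  classical
  set w := unweighted 𝒮 with hw
  have hstep : ∀ s ∈ w.support, (-1 ≤ s.1 ∧ s.1 ≤ 2) ∧ (-1 ≤ s.2 ∧ s.2 ≤ 2) := by
    intro s hs
    have := h𝒮 (mem_support_unweighted.1 hs)
    rwa [Finset.mem_product, Finset.mem_Icc, Finset.mem_Icc] at this
  have h00 := hO _ (h.left_mem 0 0)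
  have hUinj : Function.Injective (U 0) := by
    intro j j' hj
    have := h.right_mem 0 j'
    rw [← hj] at this
    rcases h.eq_or_eq 0 j _ this with h1 | h1
    · exact absurd h1.symm (h.left_ne_right 0 j')
    · exact (h.right_injective h1).symm
  have hmX : mX w ≤ 1 := Finset.sup_le fun s hs => by have := (hstep s hs).1.1; omega
  have hmY : mY w ≤ 1 := Finset.sup_le fun s hs => by have := (hstep s hs).2.1; omega
  have hMX : maxX w ≤ 2 := Finset.sup_le fun s hs => by have := (hstep s hs).1.2; omega
  -- The horizontal fibre at a 0 contains the three U 0 j; with steps in [-1,2] this forces m_x = 1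
  -- and a largest move 2.
  have hX : 3 ≤ mX w + maxX w := by
    have := h00.1.card_fibre_le' hnu.1 (T := Finset.univ.image (U 0)) (by
      intro u hu
      obtain ⟨j, -, rfl⟩ := Finset.mem_image.1 hu
      exact (hO _ (h.left_mem 0 j)).2.trans h00.2.symm)
    rwa [Finset.card_image_of_injective _ hUinj, Finset.card_univ, Fintype.card_fin] at this
  -- The vertical fibre over U 0 0 is exactly {a 0, b 0}. As m_y ≤ 1, the vertical range is [0,2] or
  -- [-1,1].
  have hY : mY w + maxY w = 2 := by
    apply le_antisymm
    · obtain ⟨T, hT, hTv⟩ := h00.1.exists_fibre hnu.2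
      rw [← hT]
      refine (Finset.card_le_card (t := {a 0, b 0}) fun v hv => ?_).trans Finset.card_le_two
      rw [Finset.mem_insert, Finset.mem_singleton]
      exact h.eq_or_eq 0 0 v (hO' _ (h.left_mem 0 0) v ((hTv v hv).trans h00.2))
    · rw [← Finset.card_pair (h.left_ne_right 0 0)]
      refine h00.1.card_fibre_le hnu.2 fun v hv => ?_
      rw [Finset.mem_insert, Finset.mem_singleton] at hv
      rcases hv with rfl | rfl
      · rfl
      · exact (hO _ (h.right_mem 0 0)).2.trans h00.2.symm
  obtain ⟨⟨i₀, j₀⟩, hs₀, hi₀⟩ := exists_mX (w := w) (by omega)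
  obtain ⟨⟨i₃, j₃⟩, hs₃, hi₃⟩ := exists_maxX (w := w) (by omega)
  obtain ⟨s₁, hs₁, hj₁⟩ := exists_maxY (w := w) (by omega)
  have hb₀ := hstep _ hs₀
  have hb₃ := hstep _ hs₃
  simp only at hi₀ hi₃ hb₀ hb₃
  have hc₀ : stepBit 𝒮 j₀ 0 = true :=
    stepBit_of_mem (mem_support_unweighted.1 hs₀) (by simp; omega)
  have hc₃ : stepBit 𝒮 j₃ 3 = true :=
    stepBit_of_mem (mem_support_unweighted.1 hs₃) (by simp; omega)
  have hc₁ := exists_stepBit h𝒮 (mem_support_unweighted.1 hs₁)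
  rw [hj₁] at hc₁
  have hmY₀ := neg_le_mY hs₀
  have hmY₃ := neg_le_mY hs₃
  have hMY₀ := le_maxY hs₀
  have hMY₃ := le_maxY hs₃
  simp only at hmY₀ hmY₃ hMY₀ hMY₃
  have hσ := eq_zero_of_eval₂_stepEval hnu.2 h00.1
  rw [h00.2] at hσ
  have haK : Function.Injective fun i => (a i : KK) := fun i j e => h.left_injective (Units.ext e)
  have hbK : Function.Injective fun i => (b i : KK) := fun i j e => h.right_injective (Units.ext e)
  have habK : ∀ i j, (a i : KK) ≠ b j := fun i j e => h.left_ne_right i j (Units.ext e)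
  have hmem : ∀ i j v, v = a i ∨ v = b j → stepEval w (U i j, v) = σ := by
    rintro i j v (rfl | rfl)
    exacts [(hO _ (h.left_mem i j)).2, (hO _ (h.right_mem i j)).2]
  rcases Nat.eq_zero_or_pos (mY w) with hm | hm
  · have hM : maxY w = 2 := by omega
    rw [hm] at hmY₀ hmY₃
    rw [hM] at hMY₀ hMY₃ hc₁
    have hgv := gridVanishes_of_grid hσ (fun k => bit (stepBit 𝒮 2 k)) (fun k => bit (stepBit 𝒮 1 k))
      (fun k => bit (stepBit 𝒮 0 k)) ![0, 0, 0, 0] ![0, 1, 0, 0] (U := fun i j => (U i j : KK))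
      haK hbK habK (by
        intro i j v hv
        obtain ⟨v, rfl⟩ : ∃ v' : KKˣ, (v' : KK) = v := hv.elim (fun e => ⟨_, e.symm⟩) fun e => ⟨_, e.symm⟩
        have hv' := hmem i j v (hv.imp Units.ext Units.ext)
        rw [stepEval_eq_sum_rows w {0, 1, 2}] at hv'
        · have e2 := mul_rowEval_unweighted h𝒮 2 (U i j)
          have e1 := mul_rowEval_unweighted h𝒮 1 (U i j)
          have e0 := mul_rowEval_unweighted h𝒮 0 (U i j)
          rw [← hw] at e0 e1 e2
          simp [Finset.sum_insert, zpow_ofNat] at hv'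
          simp only [cubicEval, Matrix.cons_val] at e0 e1 e2 ⊢
          push_cast
          linear_combination (U i j : KK) * hv' - (v : KK) ^ 2 * e2 - (v : KK) * e1 - e0
        · intro s hs
          have h1 := neg_le_mY hs
          have h2 := le_maxY hs
          simp only [Finset.mem_insert, Finset.mem_singleton]
          omega)
    have hcomp := allBool_apply (allBool_apply (allBool_apply (allBool_apply (allBool_apply (allBool_apply (allBool_apply (allBool_apply (allBool_apply (allBool_apply (allBool_apply (allBool_apply
      computation_upper (stepBit 𝒮 2 0)) (stepBit 𝒮 2 1)) (stepBit 𝒮 2 2)) (stepBit 𝒮 2 3)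
      ) (stepBit 𝒮 1 0)) (stepBit 𝒮 1 1)) (stepBit 𝒮 1 2)) (stepBit 𝒮 1 3)
      ) (stepBit 𝒮 0 0)) (stepBit 𝒮 0 1)) (stepBit 𝒮 0 2)) (stepBit 𝒮 0 3)
    have hcol₀ : (stepBit 𝒮 2 0 || stepBit 𝒮 1 0 || stepBit 𝒮 0 0) = true := by
      have : j₀ = 2 ∨ j₀ = 1 ∨ j₀ = 0 := by omega
      rcases this with rfl | rfl | rfl <;> simp [hc₀]
    have hcol₃ : (stepBit 𝒮 2 3 || stepBit 𝒮 1 3 || stepBit 𝒮 0 3) = true := by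
      have : j₃ = 2 ∨ j₃ = 1 ∨ j₃ = 0 := by omega
      rcases this with rfl | rfl | rfl <;> simp [hc₃]
    simp only [Matrix.cons_val, zero_mul, one_mul, add_zero] at hgv
    simp only [Nat.add_eq] at hcomp
    rw [hgv, hcol₀, hcol₃, show (stepBit 𝒮 2 0 || stepBit 𝒮 2 1 || stepBit 𝒮 2 2 ||
      stepBit 𝒮 2 3) = true from hc₁] at hcomp
    simp at hcomp
  · have hm1 : mY w = 1 := by omega
    have hM : maxY w = 1 := by omega
    obtain ⟨s₂, hs₂, hj₂⟩ := exists_mY hm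
    have hc₂ := exists_stepBit h𝒮 (mem_support_unweighted.1 hs₂)
    rw [hm1] at hmY₀ hmY₃ hj₂
    rw [hj₂] at hc₂
    rw [hM] at hMY₀ hMY₃ hc₁
    have heq : ∀ i j v, (v : KK) = a i ∨ (v : KK) = b j →
        cubicEval (fun k => (bit (stepBit 𝒮 1 k) : KK)) (U i j) * v ^ 2 +
          (cubicEval (fun k => (bit (stepBit 𝒮 0 k) : KK)) (U i j) - U i j * σ) * v +
            cubicEval (fun k => (bit (stepBit 𝒮 (-1) k) : KK)) (U i j) = 0 := by
      intro i j v hv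
      obtain ⟨v, rfl⟩ : ∃ v' : KKˣ, (v' : KK) = v := hv.elim (fun e => ⟨_, e.symm⟩) fun e => ⟨_, e.symm⟩
      have hv' := hmem i j v (hv.imp Units.ext Units.ext)
      rw [stepEval_eq_sum_rows w {-1, 0, 1}] at hv'
      · have e2 := mul_rowEval_unweighted h𝒮 1 (U i j)
        have e1 := mul_rowEval_unweighted h𝒮 0 (U i j)
        have e0 := mul_rowEval_unweighted h𝒮 (-1) (U i j)
        rw [← hw] at e0 e1 e2
        rw [← e0, ← e1, ← e2]
        have hv0 := v.ne_zero
        simp [Finset.sum_insert] at hv'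
        field_simp at hv'
        linear_combination (U i j : KK) * hv'
      · intro s hs
        have h1 := neg_le_mY hs
        have h2 := le_maxY hs
        simp only [Finset.mem_insert, Finset.mem_singleton]
        omega
    have hgv := gridVanishes_of_grid hσ (fun k => bit (stepBit 𝒮 1 k)) (fun k => bit (stepBit 𝒮 0 k))
      (fun k => bit (stepBit 𝒮 (-1) k)) ![0, 1, 0, 0] ![0, 0, 0, 0] (U := fun i j => (U i j : KK))
      haK hbK habK (by
        intro i j v hv
        have := heq i j v hv
        simp only [cubicEval, Matrix.cons_val] at this ⊢
        push_cast
        linear_combination this)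
    have hcomp := allBool_apply (allBool_apply (allBool_apply (allBool_apply (allBool_apply (allBool_apply (allBool_apply (allBool_apply (allBool_apply (allBool_apply (allBool_apply (allBool_apply
      computation_central (stepBit 𝒮 1 0)) (stepBit 𝒮 1 1)) (stepBit 𝒮 1 2)) (stepBit 𝒮 1 3)
      ) (stepBit 𝒮 0 0)) (stepBit 𝒮 0 1)) (stepBit 𝒮 0 2)) (stepBit 𝒮 0 3)
      ) (stepBit 𝒮 (-1) 0)) (stepBit 𝒮 (-1) 1)) (stepBit 𝒮 (-1) 2)) (stepBit 𝒮 (-1) 3)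
    have hcol₀ : (stepBit 𝒮 1 0 || stepBit 𝒮 0 0 || stepBit 𝒮 (-1) 0) = true := by
      have : j₀ = 1 ∨ j₀ = 0 ∨ j₀ = -1 := by omega
      rcases this with rfl | rfl | rfl <;> simp [hc₀]
    have hcol₃ : (stepBit 𝒮 1 3 || stepBit 𝒮 0 3 || stepBit 𝒮 (-1) 3) = true := by
      have : j₃ = 1 ∨ j₃ = 0 ∨ j₃ = -1 := by omega
      rcases this with rfl | rfl | rfl <;> simp [hc₃]
    simp only [Matrix.cons_val, zero_mul, one_mul, add_zero] at hgv
    simp only [Nat.add_eq] at hcomp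
    rw [hgv, hcol₀, hcol₃, show (stepBit 𝒮 1 0 || stepBit 𝒮 1 1 || stepBit 𝒮 1 2 ||
      stepBit 𝒮 1 3) = true from hc₁, show (stepBit 𝒮 (-1) 0 || stepBit 𝒮 (-1) 1 ||
      stepBit 𝒮 (-1) 2 || stepBit 𝒮 (-1) 3) = true from hc₂] at hcomp
    simp only [Bool.and_self, Bool.not_true, Bool.false_or, Bool.or_false, Bool.and_eq_true,
      Bool.or_eq_true, Bool.not_eq_true'] at hcomp
    -- In the exceptional models, eliminating U³ between the equations at a i and b j leaves an
    -- equation linear in U, after division by a i - b j.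
    have hfac : (∀ i j, (σ - bit (stepBit 𝒮 0 1)) * (U i j : KK) = (1 + a i) * (1 + b j)) ∨
        ∀ i j, (σ - bit (stepBit 𝒮 0 1)) * (U i j : KK) * (a i * b j) = (1 + a i) * (1 + b j) := by
      obtain ⟨⟨⟨z₀, z₂⟩, z₃⟩, hz⟩ := hcomp
      rcases hz with ⟨⟨⟨⟨⟨⟨⟨x₀, x₁⟩, x₂⟩, x₃⟩, y₀⟩, y₁⟩, y₂⟩, y₃⟩ | ⟨⟨⟨⟨⟨⟨⟨x₀, x₁⟩, x₂⟩, x₃⟩, y₀⟩, y₁⟩, y₂⟩, y₃⟩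
      · right
        intro i j
        have ea := heq i j (a i) (Or.inl rfl)
        have eb := heq i j (b j) (Or.inr rfl)
        simp only [cubicEval, x₀, x₁, x₂, x₃, y₀, y₁, y₂, y₃, z₀, z₂, z₃, bit, cond_true, cond_false,
          Nat.cast_one, Nat.cast_zero] at ea eb ⊢
        refine mul_left_cancel₀ (sub_ne_zero.2 (habK i j)) ?_
        linear_combination (b j : KK) * (1 + b j) * ea - (a i : KK) * (1 + a i) * eb
      · left
        intro i j
        have ea := heq i j (a i) (Or.inl rfl)
        have eb := heq i j (b j) (Or.inr rfl)
        simp only [cubicEval, x₀, x₁, x₂, x₃, y₀, y₁, y₂, y₃, z₀, z₂, z₃, bit, cond_true, cond_false,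
          Nat.cast_one, Nat.cast_zero] at ea eb ⊢
        refine mul_left_cancel₀ (sub_ne_zero.2 (habK i j)) ?_
        linear_combination (1 + a i : KK) * eb - (1 + b j : KK) * ea
    refine false_of_factored_grid (U := fun i j => (U i j : KK)) (fun j => (b j).ne_zero) haK hbK
      -- The value at 0 is a dummy: all a i and b j are units.
      (fun z => if hz : z = 0 then 0 else G (Units.mk0 z hz)) (fun i j => ?_) hfac
    have e1 := hFG _ (h.left_mem i j)
    have e2 := hFG _ (h.right_mem i j)
    simp only [Units.ne_zero, dite_false, Units.mk0_val] at e1 e2 ⊢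
    linear_combination e1 - e2

lemma not_hasGaloisDecoupling_of_O18 {𝒮 : Finset (ℤ × ℤ)}
    (h𝒮 : 𝒮 ⊆ Finset.Icc (-1) 2 ×ˢ Finset.Icc (-1) 2) (hnu : IsNotUnivariate (unweighted 𝒮))
    (h : HasOrbitType (unweighted 𝒮) O18) : ¬ HasGaloisDecoupling (unweighted 𝒮) (fX * fY) := by
  intro hdec
  obtain ⟨F, G, hFG⟩ := exists_decoupling_on_orbit hnu hdec
  rcases exists_isGrid h with ⟨U, a, b, hg⟩ | ⟨U, a, b, hg⟩
  · refine hg.not_decoupled h𝒮 hnu (σ := stepEval (unweighted 𝒮) (xK, yK))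
      (fun p hp => ⟨generic_of_mem_orbit hnu hp, stepEval_of_mem_orbit hp⟩) (fun p hp v hv => ?_) hFG
    exact mem_orbit_of_fst_eq hp rfl (hv.trans (stepEval_of_mem_orbit hp).symm)
  · have ht := transpose_unweighted 𝒮
    refine hg.not_decoupled (𝒮 := 𝒮.map (Equiv.prodComm ℤ ℤ).toEmbedding) ?_ ?_
      (σ := stepEval (unweighted 𝒮) (xK, yK)) (fun p hp => ⟨?_, ?_⟩) (fun p hp v hv => ?_)
      (F := G) (G := F) fun p hp => ?_
    · intro s hs
      rw [Finset.mem_map_equiv] at hs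
      have := h𝒮 hs
      rw [Finset.mem_product] at this ⊢
      exact this.symm
    · rw [← ht]
      obtain ⟨⟨s, hs, hs0⟩, ⟨r, hr, hr0⟩⟩ := hnu
      exact ⟨⟨r.swap, mem_support_transpose.2 (by rwa [Prod.swap_swap]), hr0⟩,
        ⟨s.swap, mem_support_transpose.2 (by rwa [Prod.swap_swap]), hs0⟩⟩
    · exact (generic_of_mem_orbit hnu hp).swap
    · rw [← ht, show p = p.swap.swap from rfl, stepEval_transpose]
      exact stepEval_of_mem_orbit hp
    · rw [← ht, show (p.1, v) = (v, p.1).swap from rfl, stepEval_transpose] at hv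
      exact mem_orbit_of_snd_eq (p := p.swap) hp rfl (hv.trans (stepEval_of_mem_orbit hp).symm)
    · have := hFG _ hp
      simp only [Prod.fst_swap, Prod.snd_swap] at this
      linear_combination this

/-! ### Explicit decoupling for the models `modelG` -/

lemma mX_modelG (lam : ℂ) : mX (modelG lam) = 1 := by
  refine le_antisymm (Finset.sup_le fun s hs => ?_) ?_
  · by_contra h
    refine Finsupp.mem_support_iff.1 hs ?_
    obtain ⟨i, j⟩ := s
    simp only at h
    have h : i < -1 := by omega
    simp only [modelG, Finsupp.add_apply, Finsupp.single_apply, Prod.mk.injEq]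
    simp only [h.ne', show (0 : ℤ) ≠ i by omega, show (1 : ℤ) ≠ i by omega,
      show (2 : ℤ) ≠ i by omega, false_and, if_false, add_zero]
  · have h : ((-1 : ℤ), (-1 : ℤ)) ∈ (modelG lam).support := by
      simp [modelG]
    exact Finset.le_sup (f := fun s : ℤ × ℤ => (-s.1).toNat) h

lemma mY_modelG (lam : ℂ) : mY (modelG lam) = 1 := by
  refine le_antisymm (Finset.sup_le fun s hs => ?_) ?_
  · by_contra h
    refine Finsupp.mem_support_iff.1 hs ?_
    obtain ⟨i, j⟩ := s
    simp only at h
    have h : j < -1 := by omega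
    simp only [modelG, Finsupp.add_apply, Finsupp.single_apply, Prod.mk.injEq]
    simp only [h.ne', show (0 : ℤ) ≠ j by omega, show (1 : ℤ) ≠ j by omega,
      and_false, if_false, add_zero]
  · have h : ((-1 : ℤ), (-1 : ℤ)) ∈ (modelG lam).support := by
      simp [modelG]
    exact Finset.le_sup (f := fun s : ℤ × ℤ => (-s.2).toNat) h

lemma kernelPoly_modelG (lam : ℂ) :
    kernelPoly (modelG lam) =
      X 0 * X 1 - X 2 * ((1 + X 0 ^ 2) * (1 + X 0 * X 1 ^ 2) + C lam * X 0 ^ 2 * X 1) := by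
  have hsum : ∀ w w' : WeightedModel,
      ((w + w').sum fun s c => (C c * X 0 ^ (s.1 + (1 : ℕ)).toNat * X 1 ^ (s.2 + (1 : ℕ)).toNat :
        Poly3)) =
      (w.sum fun s c => C c * X 0 ^ (s.1 + (1 : ℕ)).toNat * X 1 ^ (s.2 + (1 : ℕ)).toNat) +
      w'.sum fun s c => C c * X 0 ^ (s.1 + (1 : ℕ)).toNat * X 1 ^ (s.2 + (1 : ℕ)).toNat :=
    fun w w' => Finsupp.sum_add_index' (fun s => by rw [C_0, zero_mul, zero_mul])
      fun s a b => by rw [C_add, add_mul, add_mul]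
  have hsingle : ∀ (s : ℤ × ℤ) (a : ℂ), ((Finsupp.single s a).sum fun s c =>
      (C c * X 0 ^ (s.1 + (1 : ℕ)).toNat * X 1 ^ (s.2 + (1 : ℕ)).toNat : Poly3)) =
      C a * X 0 ^ (s.1 + (1 : ℕ)).toNat * X 1 ^ (s.2 + (1 : ℕ)).toNat :=
    fun s a => Finsupp.sum_single_index (by rw [C_0, zero_mul, zero_mul])
  rw [kernelPoly, mX_modelG, mY_modelG]
  simp only [modelG, hsum, hsingle]
  have h2 : Int.toNat 2 = 2 := rfl
  have h3 : Int.toNat 3 = 3 := rfl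
  norm_num [C_1, h2, h3]
  ring

/-- On K̃ = 0 one has XY/t - λX²Y = (1+X²)(1+XY²). Dividing by (1+X²)Y isolates 1/Y + XY on the
right and a function of X and t on the left. -/
lemma hasGaloisDecoupling_modelG (lam : ℂ) : HasGaloisDecoupling (modelG lam) (fX * fY) := by
  have hinj : Function.Injective (algebraMap Poly3 Frac3) := IsFractionRing.injective _ _
  have hS : (1 + X 0 ^ 2 : Poly3) ≠ 0 := fun h => by simpa using congrArg (eval 0) h
  have hX : fX ∈ fieldXt := IntermediateField.subset_adjoin _ _ (by simp)
  have ht : ft ∈ fieldXt := IntermediateField.subset_adjoin _ _ (by simp)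
  have hY : fY ∈ fieldYt := IntermediateField.subset_adjoin _ _ (by simp)
  have hC : algebraMap ℂ Frac3 lam ∈ fieldXt := fieldXt.algebraMap_mem lam
  have hY0 : fY ≠ 0 := (map_ne_zero_iff _ hinj).2 (X_ne_zero 1)
  have ht0 : ft ≠ 0 := (map_ne_zero_iff _ hinj).2 (X_ne_zero 2)
  have hS0 : 1 + fX ^ 2 ≠ 0 := by
    have := (map_ne_zero_iff _ hinj).2 hS
    rwa [map_add, map_one, map_pow] at this
  refine ⟨fX * (1 / ft - algebraMap ℂ Frac3 lam * fX) / (1 + fX ^ 2), ?_, -1 / fY, ?_,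
    algebraMap Poly3 Frac3 (-1) / algebraMap Poly3 Frac3 (X 2 * (1 + X 0 ^ 2) * X 1),
    ⟨-1, X 2 * (1 + X 0 ^ 2) * X 1, ?_, isUnit_one.neg.isRelPrime_left, rfl, ?_⟩, ?_⟩
  · exact div_mem (mul_mem hX (sub_mem (div_mem (one_mem _) ht) (mul_mem hC hX)))
      (add_mem (one_mem _) (pow_mem hX 2))
  · exact div_mem (neg_mem (one_mem _)) hY
  · exact mul_ne_zero (mul_ne_zero (X_ne_zero 2) hS) (X_ne_zero 1)
  · rw [kernelPoly_modelG]
    -- Regularity: the point X = 1, Y = y, with t solved from K̃ = 0, is a zero of the kernel but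
    -- not of the denominator. The condition on y cannot fail for both y = 1 and y = 2.
    have key : ∀ y : ℂ, y ≠ 0 → 2 * (1 + y ^ 2) + lam * y ≠ 0 → ¬ (X 0 * X 1 - X 2 *
        ((1 + X 0 ^ 2) * (1 + X 0 * X 1 ^ 2) + C lam * X 0 ^ 2 * X 1) : Poly3) ∣
        X 2 * (1 + X 0 ^ 2) * X 1 := by
      rintro y hy hS ⟨Q, hQ⟩
      have h := congrArg (eval ![1, y, y / (2 * (1 + y ^ 2) + lam * y)]) hQ
      simp only [map_mul, map_sub, map_add, map_one, map_pow, eval_X, eval_C,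
        Matrix.cons_val_zero, Matrix.cons_val_one, Matrix.cons_val, one_pow, one_mul, mul_one] at h
      rw [one_add_one_eq_two, div_mul_cancel₀ _ hS, sub_self, zero_mul] at h
      exact mul_ne_zero (mul_ne_zero (div_ne_zero hy hS) two_ne_zero) hy h
    by_cases h1 : 2 * (1 + (1 : ℂ) ^ 2) + lam * 1 = 0
    · refine key 2 two_ne_zero fun h2 => ?_
      have : (2 : ℂ) = 0 := by linear_combination h2 - 2 * h1
      exact two_ne_zero this
    · exact key 1 one_ne_zero h1
  · rw [kernelPoly_modelG]
    have hCX : algebraMap Poly3 Frac3 (C lam) = algebraMap ℂ Frac3 lam :=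
      (IsScalarTower.algebraMap_apply ℂ Poly3 Frac3 lam).symm
    simp only [map_mul, map_sub, map_add, map_one, map_pow, map_neg, hCX]
    rw [← fX, ← fY, ← ft]
    field_simp
    ring

end LargeSteps

end

theorem mainTheorem10 :
    -- Hadamard models, and more generally models whose orbit type is that of a Hadamard model
    (∀ w : LargeSteps.WeightedModel, LargeSteps.IsHadamard w →
      ¬ LargeSteps.HasGaloisDecoupling w (LargeSteps.fX * LargeSteps.fY)) ∧
    (∀ w : LargeSteps.WeightedModel, LargeSteps.IsNotUnivariate w →
      LargeSteps.HasHadamardOrbitType w →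
      ¬ LargeSteps.HasGaloisDecoupling w (LargeSteps.fX * LargeSteps.fY)) ∧
    -- fan models
    (∀ (p : ℕ) (z : ℕ → ℂ), 2 ≤ p → z p ≠ 0 →
      ¬ LargeSteps.HasGaloisDecoupling (LargeSteps.fan p z)
        (LargeSteps.fX * LargeSteps.fY)) ∧
    -- unweighted models with steps in `{-1, 0, 1, 2}²`
    (∀ 𝒮 : Finset (ℤ × ℤ), 𝒮 ⊆ Finset.Icc (-1) 2 ×ˢ Finset.Icc (-1) 2 →
      LargeSteps.IsNotUnivariate (LargeSteps.unweighted 𝒮) →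
      LargeSteps.HasOrbitType (LargeSteps.unweighted 𝒮) LargeSteps.O18 ∨
        LargeSteps.HasOrbitType (LargeSteps.unweighted 𝒮) LargeSteps.O12tilde →
      ¬ LargeSteps.HasGaloisDecoupling (LargeSteps.unweighted 𝒮)
        (LargeSteps.fX * LargeSteps.fY)) ∧
    -- the models `𝒢_lam`
    (∀ lam : ℂ, LargeSteps.HasGaloisDecoupling (LargeSteps.modelG lam)
      (LargeSteps.fX * LargeSteps.fY)) := by
  refine ⟨fun w h => LargeSteps.not_hasGaloisDecoupling_of_hasInducedSquare h.isNotUnivariate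
      h.hasInducedSquare, ?_, fun p z hp hz => LargeSteps.not_hasGaloisDecoupling_fan hp hz, ?_,
    LargeSteps.hasGaloisDecoupling_modelG⟩
  · rintro w hw ⟨w', hw', ⟨e⟩⟩
    exact LargeSteps.not_hasGaloisDecoupling_of_hasInducedSquare hw (hw'.hasInducedSquare.of_iso e)
  · rintro 𝒮 h𝒮 hnu (h | ⟨⟨e⟩⟩)
    · exact LargeSteps.not_hasGaloisDecoupling_of_O18 h𝒮 hnu h
    · exact LargeSteps.not_hasGaloisDecoupling_of_hasInducedSquare hnu
        (LargeSteps.hasInducedSquare_O12tilde.of_iso e)
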